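/- Let $n\ge 2$, let $\Omega\subset\mathbb{R}^n$ be open and bounded, $\alpha\in(0,1]$, $q>1$, $s\in[0,1]$, and let $a\colon\Omega\to[0,\infty)$ be $\alpha$-Hölder continuous, $a\in C^{0,\alpha}(\Omega)$. Let $\mathtt g\in C[0,\infty)$ be nondecreasing, unbounded and concave, with $t\mapsto t\,\mathtt g(t)$ convex and such that for every $\varepsilon>0$ there is $c$ with $\mathtt g(t)\le c(1+t^{\varepsilon})$ for all $t\ge0$. Let $\mathtt L\colon\mathbb{R}^n\to\mathbb{R}$ be continuous with $$\Lambda^{-1}|z|\mathtt g(|z|)\le \mathtt L(z)\le\Lambda|z|\mathtt g(|z|)+\Lambda\qquad\text{for all } z\neq0$$ and some $\Lambda\ge1$. Put $\mathtt H(x,z):=\mathtt L(z)+a(x)(s^2+|z|^2)^{q/2}$, $\mathtt G(x,t):=t\,\mathtt g(t)+a(x)t^q$ and $$\mathcal H(v;U):=\int_U \mathtt H(x,Dv)\,dx,\qquad \mathcal G(v;U):=\int_U\mathtt G(x,|Dv|)\,dx .$$ Let $\psi\in W^{1,1}_{\rm loc}(\Omega)$ satisfy $\mathcal H(\psi;V)<\infty$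 for every open $V\Subset\Omega$, and let $w\in W^{1,1}_{\rm loc}(\Omega)$ satisfy $w\ge\psi$ a.e. in $\Omega$ and $\mathtt H(\cdot,Dw)\in L^1_{\rm loc}(\Omega)$. Let $\tilde\Omega\Subset\Omega$ be open, $\varepsilon_0:=\min\{1,\mathrm{dist}(\tilde\Omega,\partial\Omega)/4\}$ and $\Omega_0:=\bigcup_{x\in\tilde\Omega}B_{\varepsilon_0}(x)$. (i) If $q<1+\alpha$, there are functions $\tilde w_\varepsilon\in W^{1,1}(\tilde\Omega)$, $0<\varepsilon<\varepsilon_0$, with $\tilde w_\varepsilon\ge\psi$ a.e. in $\tilde\Omega$, $\mathcal H(\tilde w_\varepsilon;\tilde\Omega)$ and $\mathcal G(\tilde w_\varepsilon-w;\tilde\Omega)$ finite, which are as regular as $\psi$: $\tilde w_\varepsilon-\psi$ agrees a.e. in $\tilde\Omega$ with a function in $C^\infty_c(\mathbb{R}^n)$ and, whenever $\mathbb X$ is a Sobolev space $W^{k,p}$ ($k\in\mathbb N_0$, $1\le p\le\infty$), a fractional Sobolev space $W^{k+\sigma,p}$ ($0<\sigma<1$, $1\le p<\infty$) or a Hölder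 space $C^{k,\beta}$ ($0\le\beta\le1$) and $\psi\in\mathbb X_{\rm loc}(\Omega)$ (that is, $\psi\in\mathbb X(V)$ for all open $V\Subset\Omega$), then $\tilde w_\varepsilon\in\mathbb X(\tilde\Omega)$. Moreover, as $\varepsilon\to0$, $$\tilde w_\varepsilon\to w\ \text{ strongly in } W^{1,1}(\tilde\Omega),\qquad \mathcal H(\tilde w_\varepsilon;\tilde\Omega)\to\mathcal H(w;\tilde\Omega),\qquad \mathcal G(\tilde w_\varepsilon-w;\tilde\Omega)\to0 .$$ (ii) If $q\le1+\alpha$ and $w,\psi\in L^\infty_{\rm loc}(\Omega)$, there are functions $\tilde w_\varepsilon$, $0<\varepsilon<\varepsilon_0$, with all the properties in (i) and, in addition, $$\|\tilde w_\varepsilon\|_{L^\infty(\tilde\Omega)}\le4\max\{\|w\|_{L^\infty(\Omega_0)},\|\psi\|_{L^\infty(\Omega_0)}\}\qquad\text{for all }0<\varepsilon<\varepsilon_0 .$$ -/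

import Mathlib

open MeasureTheory Filter Topology Set
open scoped ENNReal ContDiff

noncomputable section

/-- Euclidean space `ℝⁿ`. -/
abbrev Euc (n : ℕ) : Type := EuclideanSpace ℝ (Fin n)

/-- `V ⋐ U`: `V` is open and its closure is a compact subset of `U`. -/
def CompactlyIn {n : ℕ} (V U : Set (Euc n)) : Prop :=
  IsOpen V ∧ IsCompact (closure V) ∧ closure V ⊆ U

/-- The distance `inf {|x - y| : x ∈ A, y ∈ B}` of two sets. -/
def setDist {n : ℕ} (A B : Set (Euc n)) : ℝ :=
  sInf (Set.image2 dist A B)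

/-! ### Weak gradients and the space `W^{1,1}` -/

/-- `G` is a weak gradient of `f` on the open set `U`; both are locally integrable on `U`. -/
structure IsWeakGrad {n : ℕ} (U : Set (Euc n)) (f : Euc n → ℝ) (G : Euc n → Euc n) : Prop where
  locInt : LocallyIntegrableOn f U
  locInt_grad : LocallyIntegrableOn G U
  parts : ∀ φ : Euc n → ℝ, ContDiff ℝ ∞ φ → HasCompactSupport φ → tsupport φ ⊆ U →
    ∀ i : Fin n, ∫ x in U, f x * fderiv ℝ φ x (EuclideanSpace.single i 1)
      = - ∫ x in U, G x i * φ x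

/-- `f ∈ W^{1,1}_loc(U)`. -/
def MemW11Loc {n : ℕ} (U : Set (Euc n)) (f : Euc n → ℝ) : Prop :=
  ∃ G, IsWeakGrad U f G

open Classical in
/-- The weak gradient `Df` on `U` (unique up to a null set when it exists). -/
def weakGrad {n : ℕ} (U : Set (Euc n)) (f : Euc n → ℝ) : Euc n → Euc n :=
  if h : ∃ G, IsWeakGrad U f G then h.choose else 0

/-- `f ∈ W^{1,1}(U)`. -/
def MemW11 {n : ℕ} (U : Set (Euc n)) (f : Euc n → ℝ) : Prop :=
  MemW11Loc U f ∧ IntegrableOn f U ∧ IntegrableOn (weakGrad U f) U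

/-- The norm of `W^{1,1}(U)`. -/
def normW11 {n : ℕ} (U : Set (Euc n)) (f : Euc n → ℝ) : ℝ≥0∞ :=
  eLpNorm f 1 (volume.restrict U) + eLpNorm (weakGrad U f) 1 (volume.restrict U)

/-- `f ∈ L^∞_loc(U)`. -/
def MemLinftyLoc {n : ℕ} (U : Set (Euc n)) (f : Euc n → ℝ) : Prop :=
  ∀ V, CompactlyIn V U → MemLp f ∞ (volume.restrict V)

/-! ### The function spaces measuring the regularity of the obstacle -/

/-- `f ∈ W^{k,p}(U)`: `f` and all its weak derivatives up to order `k` are in `L^p(U)`. -/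
def MemSobolev {n : ℕ} (p : ℝ≥0∞) (U : Set (Euc n)) : ℕ → (Euc n → ℝ) → Prop
  | 0, f => MemLp f p (volume.restrict U)
  | k + 1, f => MemLp f p (volume.restrict U) ∧
      ∃ G, IsWeakGrad U f G ∧ ∀ i : Fin n, MemSobolev p U k (fun x => G x i)

/-- The `p`-th power of the Gagliardo seminorm `[f]_{σ,p;U}`. -/
def gagliardo {n : ℕ} (σ p : ℝ) (U : Set (Euc n)) (f : Euc n → ℝ) : ℝ≥0∞ :=
  ∫⁻ x in U, ∫⁻ y in U, ENNReal.ofReal (|f x - f y| ^ p / ‖x - y‖ ^ ((n : ℝ) + σ * p))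

/-- `f ∈ W^{k+σ,p}(U)`: `f ∈ W^{k,p}(U)` and the weak derivatives of order `k` have finite
Gagliardo seminorm. -/
def MemFracSobolev {n : ℕ} (σ p : ℝ) (U : Set (Euc n)) : ℕ → (Euc n → ℝ) → Prop
  | 0, f => MemLp f (ENNReal.ofReal p) (volume.restrict U) ∧ gagliardo σ p U f < ⊤
  | k + 1, f => MemLp f (ENNReal.ofReal p) (volume.restrict U) ∧
      ∃ G, IsWeakGrad U f G ∧ ∀ i : Fin n, MemFracSobolev σ p U k (fun x => G x i)

/-- `f ∈ C^{k,β}(U)`: up to a null set, `f` is `C^k` on the open set `U` with bounded derivatives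
up to order `k`, and the derivative of order `k` is `β`-Hölder continuous on `U`. -/
def MemHolderSpace {n : ℕ} (k : ℕ) (β : ℝ) (U : Set (Euc n)) (f : Euc n → ℝ) : Prop :=
  ∃ v : Euc n → ℝ, (∀ᵐ x ∂(volume.restrict U), f x = v x) ∧
    ContDiffOn ℝ k v U ∧
    (∀ j ≤ k, ∃ M : ℝ, ∀ x ∈ U, ‖iteratedFDeriv ℝ j v x‖ ≤ M) ∧
    ∃ M : ℝ, ∀ x ∈ U, ∀ y ∈ U,
      ‖iteratedFDeriv ℝ k v x - iteratedFDeriv ℝ k v y‖ ≤ M * ‖x - y‖ ^ β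

/-- The scales of function spaces: `W^{k,p}` with `1 ≤ p ≤ ∞`, `W^{k+σ,p}` with `0 < σ < 1` and
`1 ≤ p < ∞`, and `C^{k,β}` with `0 ≤ β ≤ 1`. -/
inductive FunctionSpace : Type
  | sobolev (k : ℕ) (p : ℝ≥0∞) (hp : 1 ≤ p)
  | fracSobolev (k : ℕ) (σ p : ℝ) (hσ : 0 < σ ∧ σ < 1) (hp : 1 ≤ p)
  | holder (k : ℕ) (β : ℝ) (hβ : 0 ≤ β ∧ β ≤ 1)

/-- `f ∈ 𝕏(U)`. -/
def FunctionSpace.Mem {n : ℕ} (X : FunctionSpace) (U : Set (Euc n)) (f : Euc n → ℝ) : Prop :=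
  match X with
  | .sobolev k p _ => MemSobolev p U k f
  | .fracSobolev k σ p _ _ => MemFracSobolev σ p U k f
  | .holder k β _ => MemHolderSpace k β U f

/-- `f ∈ 𝕏_loc(U)`. -/
def FunctionSpace.MemLoc {n : ℕ} (X : FunctionSpace) (U : Set (Euc n)) (f : Euc n → ℝ) : Prop :=
  ∀ V, CompactlyIn V U → X.Mem V f

/-! ### Constrained classes, energy and modular -/

/-- `w ∈ K^ψ_loc(U)`. -/
def MemKLoc {n : ℕ} (ψ : Euc n → ℝ) (U : Set (Euc n)) (w : Euc n → ℝ) : Prop :=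
  MemW11Loc U w ∧ ∀ᵐ x ∂(volume.restrict U), ψ x ≤ w x

/-- `w ∈ K^ψ(U)`. -/
def MemK {n : ℕ} (ψ : Euc n → ℝ) (U : Set (Euc n)) (w : Euc n → ℝ) : Prop :=
  MemW11 U w ∧ ∀ᵐ x ∂(volume.restrict U), ψ x ≤ w x

/-- Structure conditions on the function `g`. -/
structure IsGrowthFunction (g : ℝ → ℝ) : Prop where
  cont : ContinuousOn g (Ici 0)
  convex : ConvexOn ℝ (Ici 0) (fun t => t * g t)
  mono : MonotoneOn g (Ici 0)
  unbounded : ¬ BddAbove (g '' Ici 0)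
  concave : ConcaveOn ℝ (Ici 0) g
  subpower : ∀ ε : ℝ, 0 < ε → ∃ c : ℝ, ∀ t : ℝ, 0 ≤ t → g t ≤ c * (1 + t ^ ε)

/-- `H(x,z) = L(z) + a(x) (s² + |z|²)^{q/2}`. -/
def integrandH {n : ℕ} (L : Euc n → ℝ) (a : Euc n → ℝ) (s q : ℝ) (x z : Euc n) : ℝ :=
  L z + a x * (s ^ 2 + ‖z‖ ^ 2) ^ (q / 2)

/-- `G(x,t) = t g(t) + a(x) t^q`, for `t ≥ 0`. -/
def integrandG {n : ℕ} (g : ℝ → ℝ) (a : Euc n → ℝ) (q : ℝ) (x : Euc n) (t : ℝ) : ℝ :=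
  t * g t + a x * t ^ q

/-- The energy `∫_U H(x, Dw) dx` is finite. -/
def FiniteH {n : ℕ} (L : Euc n → ℝ) (a : Euc n → ℝ) (s q : ℝ) (w : Euc n → ℝ)
    (U : Set (Euc n)) : Prop :=
  IntegrableOn (fun x => integrandH L a s q x (weakGrad U w x)) U

/-- The energy `∫_U H(x, Dw) dx`. -/
def energyH {n : ℕ} (L : Euc n → ℝ) (a : Euc n → ℝ) (s q : ℝ) (w : Euc n → ℝ)
    (U : Set (Euc n)) : ℝ :=
  ∫ x in U, integrandH L a s q x (weakGrad U w x)

/-- The modular `∫_U G(x, |Dw|) dx` is finite. -/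
def FiniteG {n : ℕ} (g : ℝ → ℝ) (a : Euc n → ℝ) (q : ℝ) (w : Euc n → ℝ)
    (U : Set (Euc n)) : Prop :=
  IntegrableOn (fun x => integrandG g a q x ‖weakGrad U w x‖) U

/-- The modular `∫_U G(x, |Dw|) dx`. -/
def modularG {n : ℕ} (g : ℝ → ℝ) (a : Euc n → ℝ) (q : ℝ) (w : Euc n → ℝ)
    (U : Set (Euc n)) : ℝ :=
  ∫ x in U, integrandG g a q x ‖weakGrad U w x‖

/-- `ε₀ = min {1, dist(Ω', ∂Ω) / 4}`. -/
def epsZero {n : ℕ} (Ω' Ω : Set (Euc n)) : ℝ :=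
  min 1 (setDist Ω' (frontier Ω) / 4)

/-- The family `v ε`, `0 < ε < ε₀`, lies in `K^ψ(Ω')`, has finite energy, is as regular as the
obstacle `ψ`, and approximates `w` on `Ω'` as `ε → 0` strongly in `W^{1,1}`, in energy and in
modular. -/
structure IsRegularApprox {n : ℕ} (L : Euc n → ℝ) (g : ℝ → ℝ) (a : Euc n → ℝ) (s q : ℝ)
    (ψ w : Euc n → ℝ) (Ω Ω' : Set (Euc n)) (v : ℝ → Euc n → ℝ) : Prop where
  memK : ∀ ε ∈ Ioo 0 (epsZero Ω' Ω), MemK ψ Ω' (v ε)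
  /-- `v ε` belongs to every function space to which `ψ` locally belongs. -/
  regular : ∀ X : FunctionSpace, X.MemLoc Ω ψ →
    ∀ ε ∈ Ioo 0 (epsZero Ω' Ω), X.Mem Ω' (v ε)
  /-- `v ε` differs from `ψ` by a smooth function, hence also belongs to any other linear function
  space that contains `ψ` and the smooth functions. -/
  smooth_sub : ∀ ε ∈ Ioo 0 (epsZero Ω' Ω), ∃ η : Euc n → ℝ, ContDiff ℝ ∞ η ∧
    HasCompactSupport η ∧ ∀ᵐ x ∂(volume.restrict Ω'), v ε x = ψ x + η x
  finiteH : ∀ ε ∈ Ioo 0 (epsZero Ω' Ω), FiniteH L a s q (v ε) Ω'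
  finiteG : ∀ ε ∈ Ioo 0 (epsZero Ω' Ω), FiniteG g a q (v ε - w) Ω'
  tendsto_W11 : Tendsto (fun ε => normW11 Ω' (v ε - w)) (𝓝[>] 0) (𝓝 0)
  tendsto_H : Tendsto (fun ε => energyH L a s q (v ε) Ω') (𝓝[>] 0) (𝓝 (energyH L a s q w Ω'))
  tendsto_G : Tendsto (fun ε => modularG g a q (v ε - w) Ω') (𝓝[>] 0) (𝓝 0)

end

/-! ### Weak gradients -/

/-! The approximants are `ψ + η ε`, where `η ε` is a nonnegative test function close to `u = w - ψ ≥
0`. The obstacle constraint is then immediate. Regularity reduces to the fact that each of the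
function spaces is stable under adding a test function (`FunctionSpace.Mem.add_smooth`). What
remains is a density statement without Lavrentiev gap: `u` must be approximated by nonnegative test
functions in the double phase modular (`IsGrowthFunction.exists_smooth_approx`).

The modular used is `modDensity`, with `t g(t)` replaced by `t (g⁺(t) + 1)`. Since `g` may be
negative near zero, this change is what makes the density nonnegative and increasing. It stays
convex, is doubling by concavity of `g`, dominates `t`, so that modular convergence contains
convergence of gradients in `L¹`, and is comparable to the energy density up to integrable terms.

Density is obtained by truncating `u` smoothly and then mollifying. Truncation is harmless, because
it multiplies the gradient by a factor in `(0, 1]` tending to one. Mollification is the heart of the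
matter (`IsGrowthFunction.exists_modDensity_mollify_le`). If `|f| ≤ M`, the mollification at radius
`1/R` has gradient of size `t ≤ C M R`. Replacing `a x` by a lower bound `m` of `a` on the ball of
radius `1/R` costs at most `A R^(-α) t^q ≤ A R^(-α) (C M R)^(q-1) t`, which is at most `Q t` because
`q - 1 ≤ α` and `R ≥ 1`. With `m` frozen the density is convex in the gradient, so Jensen's
inequality moves it inside the mollification, where `m ≤ a y` restores the true coefficient. The
modular density of the mollified gradient is thus bounded by the mollification of one fixed
integrable function. Such mollifications converge in `L¹`, and dominated convergence with convergent
majorants gives modular convergence.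

Convergence of the energy follows in the same way from the growth bounds and the continuity of `L`,
along subsequences on which the gradients converge almost everywhere; convexity of `L` plays no
role. Finally, truncation and averaging keep `0 ≤ η ε` below the supremum of `|w - ψ|` nearby, which
gives the `L^∞` bound. Since truncation supplies the bounded function to be mollified, both parts of
the theorem come from the single statement `exists_isRegularApprox`. -/

theorem gradient_apply_eq_fderiv_single {n : ℕ} (η : Euc n → ℝ) (x : Euc n) (i : Fin n) :
    gradient η x i = fderiv ℝ η x (EuclideanSpace.single i 1) := by
  have h := InnerProductSpace.toDual_symm_apply (𝕜 := ℝ) (x := EuclideanSpace.single i 1)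
    (y := fderiv ℝ η x)
  rw [← h, EuclideanSpace.inner_single_right]
  simp [gradient]

theorem norm_gradient_eq_norm_fderiv {n : ℕ} (η : Euc n → ℝ) (x : Euc n) :
    ‖gradient η x‖ = ‖fderiv ℝ η x‖ := by
  simp [gradient]

theorem ContDiff.continuous_gradient {n : ℕ} {η : Euc n → ℝ} (hη : ContDiff ℝ ∞ η) :
    Continuous (gradient η) :=
  (InnerProductSpace.toDual ℝ (Euc n)).symm.continuous.comp (hη.continuous_fderiv (by simp))

theorem MeasureTheory.LocallyIntegrableOn.euclidean_apply {n : ℕ} {U : Set (Euc n)}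
    {G : Euc n → Euc n} (hG : LocallyIntegrableOn G U) (i : Fin n) :
    LocallyIntegrableOn (fun x => G x i) U := by
  intro x hx
  obtain ⟨s, hs, h⟩ := hG x hx
  exact ⟨s, hs, (EuclideanSpace.proj (𝕜 := ℝ) i).integrable_comp h⟩

/-- The product of a function locally integrable on `U` with a continuous function compactly
supported in `U` is integrable. -/
theorem MeasureTheory.LocallyIntegrableOn.integrable_mul_of_tsupport_subset {n : ℕ}
    {U : Set (Euc n)} {f φ : Euc n → ℝ} (hf : LocallyIntegrableOn f U) (hφ : Continuous φ)
    (hc : HasCompactSupport φ) (hs : tsupport φ ⊆ U) : Integrable (fun x => f x * φ x) := by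
  have h1 : IntegrableOn (fun x => f x * φ x) (tsupport φ) :=
    (hf.integrableOn_compact_subset hs hc).mul_continuousOn hφ.continuousOn hc
  rw [integrableOn_iff_integrable_of_support_subset] at h1
  · exact h1
  · intro x hx
    exact subset_tsupport _ (right_ne_zero_of_mul hx)

theorem setIntegral_mul_eq_integral_of_tsupport_subset {n : ℕ} {U : Set (Euc n)}
    (f : Euc n → ℝ) {φ : Euc n → ℝ} (hs : tsupport φ ⊆ U) :
    ∫ x in U, f x * φ x = ∫ x, f x * φ x := by
  refine setIntegral_eq_integral_of_forall_compl_eq_zero fun x hx => ?_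
  rw [image_eq_zero_of_notMem_tsupport fun h => hx (hs h), mul_zero]

/-- The defining identity of a weak gradient, with integrals over the whole space. -/
theorem IsWeakGrad.integral_mul_fderiv {n : ℕ} {U : Set (Euc n)} {f : Euc n → ℝ}
    {G : Euc n → Euc n} (h : IsWeakGrad U f G) {φ : Euc n → ℝ} (hφ : ContDiff ℝ ∞ φ)
    (hc : HasCompactSupport φ) (hs : tsupport φ ⊆ U) (i : Fin n) :
    ∫ x, f x * fderiv ℝ φ x (EuclideanSpace.single i 1) = - ∫ x, G x i * φ x := by
  rw [← setIntegral_mul_eq_integral_of_tsupport_subset (U := U) (fun x => G x i) hs,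
    ← h.parts φ hφ hc hs i,
    setIntegral_mul_eq_integral_of_tsupport_subset f ((tsupport_fderiv_apply_subset ℝ _).trans hs)]

/-- A test function and its derivatives vanish off `U`, so the set under the integral can be
dropped. Restriction to subsets and the algebra of weak gradients then need no measurability of `U`.
-/
theorem isWeakGrad_of_integral {n : ℕ} {U : Set (Euc n)} {f : Euc n → ℝ}
    {G : Euc n → Euc n} (hf : LocallyIntegrableOn f U) (hG : LocallyIntegrableOn G U)
    (h : ∀ φ : Euc n → ℝ, ContDiff ℝ ∞ φ → HasCompactSupport φ → tsupport φ ⊆ U →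
      ∀ i : Fin n, ∫ x, f x * fderiv ℝ φ x (EuclideanSpace.single i 1) = - ∫ x, G x i * φ x) :
    IsWeakGrad U f G := by
  refine ⟨hf, hG, fun φ hφ hc hs i => ?_⟩
  rw [setIntegral_mul_eq_integral_of_tsupport_subset (fun x => G x i) hs,
    setIntegral_mul_eq_integral_of_tsupport_subset f ((tsupport_fderiv_apply_subset ℝ _).trans hs)]
  exact h φ hφ hc hs i

theorem IsWeakGrad.mono {n : ℕ} {U V : Set (Euc n)} {f : Euc n → ℝ} {G : Euc n → Euc n}
    (h : IsWeakGrad U f G) (hVU : V ⊆ U) : IsWeakGrad V f G :=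
  isWeakGrad_of_integral (h.locInt.mono_set hVU) (h.locInt_grad.mono_set hVU)
    fun _ hφ hc hs i => h.integral_mul_fderiv hφ hc (hs.trans hVU) i

theorem IsWeakGrad.ae_eq {n : ℕ} {U : Set (Euc n)} (hU : IsOpen U) {f : Euc n → ℝ}
    {G₁ G₂ : Euc n → Euc n} (h₁ : IsWeakGrad U f G₁) (h₂ : IsWeakGrad U f G₂) :
    G₁ =ᵐ[volume.restrict U] G₂ := by
  have key : ∀ i : Fin n, ∀ᵐ x ∂(volume : Measure (Euc n)), x ∈ U → G₁ x i - G₂ x i = 0 := by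
    intro i
    refine hU.ae_eq_zero_of_integral_contDiff_smul_eq_zero
      ((h₁.locInt_grad.euclidean_apply i).sub (h₂.locInt_grad.euclidean_apply i))
      fun φ hφ hc hs => ?_
    have e1 := h₁.integral_mul_fderiv hφ hc hs i
    have e2 := h₂.integral_mul_fderiv hφ hc hs i
    have i1 := (h₁.locInt_grad.euclidean_apply i).integrable_mul_of_tsupport_subset
      hφ.continuous hc hs
    have i2 := (h₂.locInt_grad.euclidean_apply i).integrable_mul_of_tsupport_subset
      hφ.continuous hc hs
    have : ∫ x, φ x • (G₁ x i - G₂ x i) = ∫ x, (G₁ x i * φ x - G₂ x i * φ x) := by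
      congr 1; ext x; simp only [smul_eq_mul]; ring
    rw [this, integral_sub i1 i2]
    linarith
  rw [Filter.EventuallyEq, ae_restrict_iff' hU.measurableSet]
  filter_upwards [ae_all_iff.2 key] with x hx hxU
  ext i
  exact sub_eq_zero.1 (hx i hxU)

theorem IsWeakGrad.add {n : ℕ} {U : Set (Euc n)} {f₁ f₂ : Euc n → ℝ}
    {G₁ G₂ : Euc n → Euc n} (h₁ : IsWeakGrad U f₁ G₁) (h₂ : IsWeakGrad U f₂ G₂) :
    IsWeakGrad U (f₁ + f₂) (G₁ + G₂) := by
  refine isWeakGrad_of_integral (h₁.locInt.add h₂.locInt) (h₁.locInt_grad.add h₂.locInt_grad)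
    fun φ hφ hc hs i => ?_
  have hc' : HasCompactSupport (fun x => fderiv ℝ φ x (EuclideanSpace.single i 1)) :=
    hc.fderiv_apply ℝ _
  have hs' := (tsupport_fderiv_apply_subset ℝ (f := φ) (EuclideanSpace.single i 1)).trans hs
  have hφ' : Continuous (fun x => fderiv ℝ φ x (EuclideanSpace.single i 1)) :=
    (hφ.continuous_fderiv (by simp)).clm_apply continuous_const
  simp only [Pi.add_apply, PiLp.add_apply, add_mul]
  rw [integral_add (h₁.locInt.integrable_mul_of_tsupport_subset hφ' hc' hs')
    (h₂.locInt.integrable_mul_of_tsupport_subset hφ' hc' hs'),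
    integral_add ((h₁.locInt_grad.euclidean_apply i).integrable_mul_of_tsupport_subset
      hφ.continuous hc hs)
    ((h₂.locInt_grad.euclidean_apply i).integrable_mul_of_tsupport_subset hφ.continuous hc hs),
    h₁.integral_mul_fderiv hφ hc hs i, h₂.integral_mul_fderiv hφ hc hs i]
  ring

theorem IsWeakGrad.neg {n : ℕ} {U : Set (Euc n)} {f : Euc n → ℝ}
    {G : Euc n → Euc n} (h : IsWeakGrad U f G) : IsWeakGrad U (-f) (-G) := by
  refine isWeakGrad_of_integral h.locInt.neg h.locInt_grad.neg fun φ hφ hc hs i => ?_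
  simp only [Pi.neg_apply, PiLp.neg_apply, neg_mul, integral_neg]
  rw [h.integral_mul_fderiv hφ hc hs i]

theorem IsWeakGrad.sub {n : ℕ} {U : Set (Euc n)} {f₁ f₂ : Euc n → ℝ}
    {G₁ G₂ : Euc n → Euc n} (h₁ : IsWeakGrad U f₁ G₁) (h₂ : IsWeakGrad U f₂ G₂) :
    IsWeakGrad U (f₁ - f₂) (G₁ - G₂) := by
  simpa only [sub_eq_add_neg] using h₁.add h₂.neg

theorem ContDiff.isWeakGrad {n : ℕ} (U : Set (Euc n)) {η : Euc n → ℝ} (hη : ContDiff ℝ ∞ η) :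
    IsWeakGrad U η (gradient η) := by
  refine isWeakGrad_of_integral (hη.continuous.locallyIntegrable.locallyIntegrableOn _)
    (hη.continuous_gradient.locallyIntegrable.locallyIntegrableOn _) fun φ hφ hc _ i => ?_
  simp only [gradient_apply_eq_fderiv_single]
  have hφ' : Continuous (fun x => fderiv ℝ φ x (EuclideanSpace.single i 1)) :=
    (hφ.continuous_fderiv (by simp)).clm_apply continuous_const
  have hη' : Continuous (fun x => fderiv ℝ η x (EuclideanSpace.single i 1)) :=
    (hη.continuous_fderiv (by simp)).clm_apply continuous_const
  exact integral_mul_fderiv_eq_neg_fderiv_mul_of_integrable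
    ((hη'.mul hφ.continuous).integrable_of_hasCompactSupport hc.mul_left)
    ((hη.continuous.mul hφ').integrable_of_hasCompactSupport (hc.fderiv_apply ℝ _).mul_left)
    ((hη.continuous.mul hφ.continuous).integrable_of_hasCompactSupport hc.mul_left)
    (fun x _ => hη.differentiable (by simp) x) (fun x _ => hφ.differentiable (by simp) x)

theorem MemW11Loc.isWeakGrad_weakGrad {n : ℕ} {U : Set (Euc n)} {f : Euc n → ℝ}
    (h : MemW11Loc U f) : IsWeakGrad U f (weakGrad U f) := by
  have h' : ∃ G, IsWeakGrad U f G := h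
  rw [weakGrad, dif_pos h']
  exact h'.choose_spec

/-- `weakGrad` is an arbitrary choice made separately on each open set. By uniqueness almost
everywhere, energies written with it can be computed with any explicit gradient, in particular with
the restriction of a gradient from a larger set. -/
theorem IsWeakGrad.weakGrad_ae_eq {n : ℕ} {U : Set (Euc n)} (hU : IsOpen U) {f : Euc n → ℝ}
    {G : Euc n → Euc n} (h : IsWeakGrad U f G) : weakGrad U f =ᵐ[volume.restrict U] G :=
  IsWeakGrad.ae_eq hU (MemW11Loc.isWeakGrad_weakGrad ⟨G, h⟩) h

/-! ### Adding a test function to an element of a function space -/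

theorem Real.add_rpow_le_two_rpow_mul {a b p : ℝ} (ha : 0 ≤ a) (hb : 0 ≤ b) (hp : 0 ≤ p) :
    (a + b) ^ p ≤ 2 ^ p * (a ^ p + b ^ p) := by
  have h1 : a + b ≤ 2 * max a b := by
    linarith [le_max_left a b, le_max_right a b]
  have h2 : (max a b) ^ p ≤ a ^ p + b ^ p := by
    rcases max_choice a b with h | h <;> rw [h]
    · linarith [Real.rpow_nonneg hb p]
    · linarith [Real.rpow_nonneg ha p]
  calc (a + b) ^ p ≤ (2 * max a b) ^ p := Real.rpow_le_rpow (by positivity) h1 hp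
    _ = 2 ^ p * (max a b) ^ p := Real.mul_rpow (by norm_num) (le_max_of_le_left ha)
    _ ≤ _ := by gcongr

theorem ContDiff.fderiv_apply_const {n : ℕ} {η : Euc n → ℝ} (hη : ContDiff ℝ ∞ η) (v : Euc n) :
    ContDiff ℝ ∞ (fun x => fderiv ℝ η x v) :=
  (hη.fderiv_right (m := ∞) (by simp)).clm_apply contDiff_const

/-- Induction on the order: the partial derivatives of a test function are again test functions, so
the induction hypothesis applies to each component of the gradient. -/
theorem MemSobolev.add_smooth {n : ℕ} {p : ℝ≥0∞} {U : Set (Euc n)} :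
    ∀ {k : ℕ} {f η : Euc n → ℝ}, MemSobolev p U k f → ContDiff ℝ ∞ η → HasCompactSupport η →
      MemSobolev p U k (f + η)
  | 0, _, _, hf, hη, hc =>
    MemLp.add hf ((hη.continuous.memLp_of_hasCompactSupport hc).restrict U)
  | k + 1, f, η, ⟨hf, G, hG, hGk⟩, hη, hc => by
    refine ⟨hf.add ((hη.continuous.memLp_of_hasCompactSupport hc).restrict U),
      G + gradient η, hG.add (hη.isWeakGrad U), fun i => ?_⟩
    have := (hGk i).add_smooth (hη.fderiv_apply_const (EuclideanSpace.single i 1))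
      (hc.fderiv_apply ℝ _)
    convert this using 1
    ext x
    simp [gradient_apply_eq_fderiv_single]

/-- Differences of points of `U` lie in the ball of radius `2 * R`, on which the kernel is
integrable since `γ < n`. Translation invariance makes the bound independent of `x`. -/
theorem lintegral_norm_sub_rpow_neg_le {n : ℕ} (hn : 1 ≤ n) {γ R : ℝ} (hγ : γ < n)
    {U : Set (Euc n)} (hUm : MeasurableSet U) (hU : U ⊆ Metric.ball 0 R) :
    ∃ C : ℝ≥0∞, C < ⊤ ∧ ∀ x ∈ U, ∫⁻ y in U, ENNReal.ofReal (‖x - y‖ ^ (-γ)) ≤ C := by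
  refine ⟨∫⁻ z in Metric.ball (0 : Euc n) (2 * R), ENNReal.ofReal (‖z‖ ^ (-γ)), ?_, ?_⟩
  · have hm : Measurable (fun z : Euc n => ‖z‖ ^ (-γ)) := by fun_prop
    have : IntegrableOn (fun z : Euc n => ‖z‖ ^ (-γ)) (Metric.ball 0 (2 * R)) := by
      refine integrableOn_ball_of_norm_le_rpow (C := 1) (α := γ) (by simpa using hn)
        (by simpa using hγ) (ae_of_all _ fun x => ?_) hm.aestronglyMeasurable
      rw [Real.norm_of_nonneg (by positivity), one_mul]
    exact this.lintegral_lt_top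
  · intro x hx
    calc ∫⁻ y in U, ENNReal.ofReal (‖x - y‖ ^ (-γ))
        ≤ ∫⁻ y in U, (Metric.ball (0 : Euc n) (2 * R)).indicator
            (fun z => ENNReal.ofReal (‖z‖ ^ (-γ))) (x - y) := by
          refine setLIntegral_mono' hUm fun y hy => ?_
          have hxy : x - y ∈ Metric.ball (0 : Euc n) (2 * R) := by
            have h1 := mem_ball_zero_iff.1 (hU hx)
            have h2 := mem_ball_zero_iff.1 (hU hy)
            rw [mem_ball_zero_iff]
            linarith [norm_sub_le x y]
          rw [indicator_of_mem hxy]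
      _ ≤ ∫⁻ y, (Metric.ball (0 : Euc n) (2 * R)).indicator
            (fun z => ENNReal.ofReal (‖z‖ ^ (-γ))) (x - y) := setLIntegral_le_lintegral _ _
      _ = ∫⁻ z, (Metric.ball (0 : Euc n) (2 * R)).indicator
            (fun z => ENNReal.ofReal (‖z‖ ^ (-γ))) z := lintegral_sub_left_eq_self _ x
      _ = _ := lintegral_indicator Metric.isOpen_ball.measurableSet _

/-- The Lipschitz bound gains a factor `‖x - y‖ ^ p`, which lowers the singularity to the exponent
`n + σ * p - p`. This is below `n` exactly because `σ < 1`, and the outer integral is finite since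
`U` is bounded. -/
theorem gagliardo_lt_top_of_lipschitz {n : ℕ} (hn : 1 ≤ n) {σ p : ℝ} (hσ : σ < 1) (hp : 0 < p)
    {U : Set (Euc n)} (hUm : MeasurableSet U) (hU : Bornology.IsBounded U) {η : Euc n → ℝ} {M : ℝ}
    (hη : ∀ x y, |η x - η y| ≤ M * ‖x - y‖) : gagliardo σ p U η < ⊤ := by
  obtain ⟨R, hR⟩ := hU.subset_ball 0
  obtain ⟨C, hC, hCU⟩ := lintegral_norm_sub_rpow_neg_le hn (γ := n + σ * p - p)
    (by nlinarith) hUm hR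
  have hvol : volume U < ⊤ := hU.measure_lt_top
  have hpt : ∀ x y : Euc n, ENNReal.ofReal (|η x - η y| ^ p / ‖x - y‖ ^ ((n : ℝ) + σ * p)) ≤
      ENNReal.ofReal (|M| ^ p) * ENNReal.ofReal (‖x - y‖ ^ (-((n : ℝ) + σ * p - p))) := by
    intro x y
    rw [← ENNReal.ofReal_mul (by positivity)]
    refine ENNReal.ofReal_le_ofReal ?_
    rcases eq_or_ne x y with rfl | hxy
    · simp only [sub_self, abs_zero, norm_zero, Real.zero_rpow hp.ne', zero_div]
      positivity
    · have hpos : 0 < ‖x - y‖ := norm_pos_iff.2 (sub_ne_zero.2 hxy)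
      have h1 : |η x - η y| ^ p ≤ |M| ^ p * ‖x - y‖ ^ p := by
        rw [← Real.mul_rpow (abs_nonneg _) hpos.le]
        refine Real.rpow_le_rpow (abs_nonneg _) ((hη x y).trans ?_) hp.le
        gcongr
        exact le_abs_self M
      rw [div_le_iff₀ (by positivity), mul_assoc, ← Real.rpow_add hpos]
      simpa using h1
  calc gagliardo σ p U η
      ≤ ∫⁻ x in U, ENNReal.ofReal (|M| ^ p) * C := by
        refine setLIntegral_mono' hUm fun x hx => ?_
        calc _ ≤ ∫⁻ y in U, ENNReal.ofReal (|M| ^ p) *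
                ENNReal.ofReal (‖x - y‖ ^ (-((n : ℝ) + σ * p - p))) :=
              lintegral_mono fun y => hpt x y
          _ = ENNReal.ofReal (|M| ^ p) *
                ∫⁻ y in U, ENNReal.ofReal (‖x - y‖ ^ (-((n : ℝ) + σ * p - p))) :=
              lintegral_const_mul' _ _ ENNReal.ofReal_ne_top
          _ ≤ _ := by gcongr; exact hCU x hx
    _ = ENNReal.ofReal (|M| ^ p) * C * volume U := by simp
    _ < ⊤ := ENNReal.mul_lt_top (ENNReal.mul_lt_top ENNReal.ofReal_lt_top hC) hvol

/-- Additivity of the lower integral needs measurability of one summand only. Here `D` is to come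
from the smooth function, so nothing is asked of the term of the rough function. -/
theorem lintegral_lintegral_le_of_le_const_mul_add {X : Type*} [MeasurableSpace X]
    {μ : Measure X} [SFinite μ] {A B D : X → X → ℝ≥0∞} {c : ℝ≥0∞} (hc : c ≠ ⊤)
    (h : ∀ x y, A x y ≤ c * (B x y + D x y)) (hD : Measurable (Function.uncurry D)) :
    ∫⁻ x, ∫⁻ y, A x y ∂μ ∂μ ≤
      c * ((∫⁻ x, ∫⁻ y, B x y ∂μ ∂μ) + ∫⁻ x, ∫⁻ y, D x y ∂μ ∂μ) := by
  rw [← lintegral_add_right _ hD.lintegral_prod_right, ← lintegral_const_mul' _ _ hc]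
  refine lintegral_mono fun x => ?_
  have hDx : Measurable (D x) := hD.comp measurable_prodMk_left
  change ∫⁻ y, A x y ∂μ ≤ c * (∫⁻ y, B x y ∂μ + ∫⁻ y, D x y ∂μ)
  rw [← lintegral_add_right _ hDx, ← lintegral_const_mul' _ _ hc]
  exact lintegral_mono fun y => h x y

theorem gagliardo_add_lt_top {n : ℕ} {σ p : ℝ} (hp : 0 ≤ p) {U : Set (Euc n)}
    {f η : Euc n → ℝ} (hf : gagliardo σ p U f < ⊤) (hη : gagliardo σ p U η < ⊤)
    (hηm : Measurable η) : gagliardo σ p U (f + η) < ⊤ := by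
  have hpt : ∀ x y : Euc n,
      ENNReal.ofReal (|(f + η) x - (f + η) y| ^ p / ‖x - y‖ ^ ((n : ℝ) + σ * p)) ≤
      ENNReal.ofReal (2 ^ p) *
        (ENNReal.ofReal (|f x - f y| ^ p / ‖x - y‖ ^ ((n : ℝ) + σ * p)) +
          ENNReal.ofReal (|η x - η y| ^ p / ‖x - y‖ ^ ((n : ℝ) + σ * p))) := by
    intro x y
    rw [← ENNReal.ofReal_add (by positivity) (by positivity),
      ← ENNReal.ofReal_mul (by positivity), ← add_div, ← mul_div_assoc]
    refine ENNReal.ofReal_le_ofReal ?_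
    gcongr
    refine le_trans (Real.rpow_le_rpow (abs_nonneg _) ?_ hp)
      (Real.add_rpow_le_two_rpow_mul (abs_nonneg _) (abs_nonneg _) hp)
    simp only [Pi.add_apply, add_sub_add_comm]
    exact abs_add_le _ _
  have hm : Measurable (Function.uncurry fun x y : Euc n =>
      ENNReal.ofReal (|η x - η y| ^ p / ‖x - y‖ ^ ((n : ℝ) + σ * p))) := by
    unfold Function.uncurry
    fun_prop
  refine lt_of_le_of_lt
    (lintegral_lintegral_le_of_le_const_mul_add ENNReal.ofReal_ne_top hpt hm) ?_
  exact ENNReal.mul_lt_top ENNReal.ofReal_lt_top (ENNReal.add_lt_top.2 ⟨hf, hη⟩)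

theorem HasCompactSupport.exists_norm_sub_le_of_contDiff {n : ℕ} {F : Type*}
    [NormedAddCommGroup F] [NormedSpace ℝ F] {η : Euc n → F} (hη : ContDiff ℝ 1 η)
    (hc : HasCompactSupport η) : ∃ M : ℝ, 0 ≤ M ∧ ∀ x y, ‖η x - η y‖ ≤ M * ‖x - y‖ := by
  obtain ⟨C, hC⟩ := hη.lipschitzWith_of_hasCompactSupport hc (by simp)
  exact ⟨C, C.2, fun x y => hC.norm_sub_le x y⟩

theorem MemFracSobolev.add_smooth {n : ℕ} (hn : 1 ≤ n) {σ p : ℝ} (hσ : σ < 1) (hp : 1 ≤ p)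
    {U : Set (Euc n)} (hUm : MeasurableSet U) (hU : Bornology.IsBounded U) :
    ∀ {k : ℕ} {f η : Euc n → ℝ}, MemFracSobolev σ p U k f → ContDiff ℝ ∞ η →
      HasCompactSupport η → MemFracSobolev σ p U k (f + η)
  | 0, f, η, ⟨hf, hfg⟩, hη, hc => by
    obtain ⟨M, _, hM⟩ := hc.exists_norm_sub_le_of_contDiff (hη.of_le (by simp))
    exact ⟨hf.add ((hη.continuous.memLp_of_hasCompactSupport hc).restrict U),
      gagliardo_add_lt_top (by linarith) hfg
        (gagliardo_lt_top_of_lipschitz hn hσ (by linarith) hUm hU hM) hη.continuous.measurable⟩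
  | k + 1, f, η, ⟨hf, G, hG, hGk⟩, hη, hc => by
    refine ⟨hf.add ((hη.continuous.memLp_of_hasCompactSupport hc).restrict U),
      G + gradient η, hG.add (hη.isWeakGrad U), fun i => ?_⟩
    have := (hGk i).add_smooth hn hσ hp hUm hU
      (hη.fderiv_apply_const (EuclideanSpace.single i 1)) (hc.fderiv_apply ℝ _)
    convert this using 1
    ext x
    simp [gradient_apply_eq_fderiv_single]

/-- At distances below one the Lipschitz bound is used, since there `r ≤ r ^ β`; at larger distances
the sup bound suffices, since `1 ≤ r ^ β`. -/
theorem norm_sub_le_rpow_of_bounded_of_lipschitz {E F : Type*} [NormedAddCommGroup E]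
    [NormedAddCommGroup F] {f : E → F} {M K β : ℝ} (hK : 0 ≤ K)
    (hM : ∀ x, ‖f x‖ ≤ M) (hL : ∀ x y, ‖f x - f y‖ ≤ K * ‖x - y‖) (hβ0 : 0 ≤ β) (hβ1 : β ≤ 1) :
    ∀ x y, ‖f x - f y‖ ≤ (K + 2 * M) * ‖x - y‖ ^ β := by
  intro x y
  have hM0 : 0 ≤ M := (norm_nonneg _).trans (hM x)
  rcases le_total ‖x - y‖ 1 with h | h
  · have h2 : ‖x - y‖ ≤ ‖x - y‖ ^ β := by
      rcases (norm_nonneg (x - y)).eq_or_lt with h0 | h0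
      · rw [← h0]; positivity
      · simpa using Real.rpow_le_rpow_of_exponent_ge h0 h hβ1
    calc _ ≤ K * ‖x - y‖ := hL x y
      _ ≤ K * ‖x - y‖ ^ β := by gcongr
      _ ≤ _ := by gcongr; linarith
  · have h2 : 1 ≤ ‖x - y‖ ^ β := Real.one_le_rpow h hβ0
    calc _ ≤ ‖f x‖ + ‖f y‖ := norm_sub_le _ _
      _ ≤ 2 * M := by linarith [hM x, hM y]
      _ ≤ (K + 2 * M) * 1 := by linarith
      _ ≤ _ := by gcongr

theorem HasCompactSupport.exists_norm_le {n : ℕ} {F : Type*} [NormedAddCommGroup F]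
    {η : Euc n → F} (hη : Continuous η) (hc : HasCompactSupport η) : ∃ M : ℝ, ∀ x, ‖η x‖ ≤ M :=
  hη.bounded_above_of_compact_support hc

/-- As `U` is open, the representative is `C^k` at each of its points, so the iterated derivatives
are additive there. Those of the test function are bounded and Lipschitz, hence Hölder of every
exponent in `[0, 1]`. -/
theorem MemHolderSpace.add_smooth {n : ℕ} {k : ℕ} {β : ℝ} (hβ : 0 ≤ β ∧ β ≤ 1)
    {U : Set (Euc n)} (hU : IsOpen U) {f η : Euc n → ℝ} (hf : MemHolderSpace k β U f)
    (hη : ContDiff ℝ ∞ η) (hc : HasCompactSupport η) : MemHolderSpace k β U (f + η) := by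
  obtain ⟨v, hfv, hv, hvb, M, hvM⟩ := hf
  have hadd : ∀ j ≤ k, ∀ x ∈ U,
      iteratedFDeriv ℝ j (v + η) x = iteratedFDeriv ℝ j v x + iteratedFDeriv ℝ j η x := by
    intro j hj x hx
    exact iteratedFDeriv_add_apply
      ((hv.contDiffAt (hU.mem_nhds hx)).of_le (by exact_mod_cast hj))
      (hη.contDiffAt.of_le (by exact_mod_cast le_top))
  have hηc : ∀ j : ℕ, ContDiff ℝ 1 (iteratedFDeriv ℝ j η) := fun j =>
    hη.iteratedFDeriv_right (by exact_mod_cast le_top)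
  refine ⟨v + η, ?_, hv.add (hη.of_le (by exact_mod_cast le_top)).contDiffOn, fun j hj => ?_, ?_⟩
  · filter_upwards [hfv] with x hx
    simp [hx]
  · obtain ⟨A, hA⟩ := hvb j hj
    obtain ⟨B, hB⟩ := (hc.iteratedFDeriv (𝕜 := ℝ) j).exists_norm_le (hηc j).continuous
    refine ⟨A + B, fun x hx => ?_⟩
    rw [hadd j hj x hx]
    exact (norm_add_le _ _).trans (add_le_add (hA x hx) (hB x))
  · obtain ⟨B, hB⟩ := (hc.iteratedFDeriv (𝕜 := ℝ) k).exists_norm_le (hηc k).continuous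
    obtain ⟨K, hK0, hK⟩ := (hc.iteratedFDeriv (𝕜 := ℝ) k).exists_norm_sub_le_of_contDiff (hηc k)
    refine ⟨M + (K + 2 * B), fun x hx y hy => ?_⟩
    rw [hadd k le_rfl x hx, hadd k le_rfl y hy, add_sub_add_comm, add_mul]
    exact (norm_add_le _ _).trans (add_le_add (hvM x hx y hy)
      (norm_sub_le_rpow_of_bounded_of_lipschitz hK0 hB hK hβ.1 hβ.2 x y))

theorem FunctionSpace.Mem.add_smooth {n : ℕ} (hn : 1 ≤ n) {X : FunctionSpace} {U : Set (Euc n)}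
    (hU : IsOpen U) (hUb : Bornology.IsBounded U) {f η : Euc n → ℝ} (hf : X.Mem U f)
    (hη : ContDiff ℝ ∞ η) (hc : HasCompactSupport η) : X.Mem U (f + η) := by
  cases X with
  | sobolev k p hp => exact MemSobolev.add_smooth hf hη hc
  | fracSobolev k σ p hσ hp =>
    exact MemFracSobolev.add_smooth hn hσ.2 hp hU.measurableSet hUb hf hη hc
  | holder k β hβ => exact MemHolderSpace.add_smooth hβ hU hf hη hc

noncomputable section

/-! ### Convergence of integrals under a convergent family of dominating functions -/

/-- Dominated convergence to zero, where the dominating functions converge in `L¹`. -/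
theorem tendsto_integral_zero_of_le_of_tendsto_L1 {X : Type*} [MeasurableSpace X] {μ : Measure X}
    {f h : ℕ → X → ℝ} {H : X → ℝ} (hf : ∀ j, AEStronglyMeasurable (f j) μ)
    (hf0 : ∀ j, ∀ᵐ x ∂μ, 0 ≤ f j x) (hfh : ∀ j, ∀ᵐ x ∂μ, f j x ≤ h j x)
    (hh : ∀ j, Integrable (h j) μ) (hH : Integrable H μ)
    (hlim : ∀ᵐ x ∂μ, Tendsto (fun j => f j x) atTop (𝓝 0))
    (hhH : Tendsto (fun j => ∫ x, |h j x - H x| ∂μ) atTop (𝓝 0)) :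
    Tendsto (fun j => ∫ x, f j x ∂μ) atTop (𝓝 0) := by
  -- Cutting `f j` at the fixed integrable level `|H|` makes ordinary dominated convergence
  -- applicable. The part cut off is at most `|h j - H|`, whose integral tends to zero by
  -- hypothesis.
  have hm : Tendsto (fun j => ∫ x, min (f j x) |H x| ∂μ) atTop (𝓝 0) := by
    have : Tendsto (fun j => ∫ x, min (f j x) |H x| ∂μ) atTop (𝓝 (∫ _, (0 : ℝ) ∂μ)) := by
      refine tendsto_integral_of_dominated_convergence (fun x => |H x|)
        (fun j => (hf j).inf hH.abs.aestronglyMeasurable) hH.abs (fun j => ?_) ?_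
      · filter_upwards [hf0 j] with x hx
        rw [Real.norm_of_nonneg (le_min hx (abs_nonneg _))]
        exact min_le_right _ _
      · filter_upwards [hlim] with x hx
        have := hx.min (tendsto_const_nhds (x := |H x|))
        rwa [min_eq_left (abs_nonneg _)] at this
    simpa using this
  have hfi : ∀ j, Integrable (f j) μ := fun j => by
    refine (hh j).mono' (hf j) ?_
    filter_upwards [hf0 j, hfh j] with x h0 h1
    rwa [Real.norm_of_nonneg h0]
  have hmi : ∀ j, Integrable (fun x => min (f j x) |H x|) μ := fun j => (hfi j).inf hH.abs
  refine squeeze_zero (fun j => integral_nonneg_of_ae (hf0 j)) (fun j => ?_)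
    (by simpa using hm.add hhH)
  have hd : Integrable (fun x => |h j x - H x|) μ := ((hh j).sub hH).abs
  rw [← integral_add (hmi j) hd]
  refine integral_mono_ae (hfi j) ((hmi j).add hd) ?_
  filter_upwards [hfh j] with x hx
  rcases le_total (f j x) |H x| with h1 | h1
  · rw [min_eq_left h1]; linarith [abs_nonneg (h j x - H x)]
  · rw [min_eq_right h1]
    linarith [le_abs_self (h j x - H x), le_abs_self (H x)]

/-- **Scheffé's lemma**. -/
theorem tendsto_integral_abs_sub_of_tendsto_integral {X : Type*} [MeasurableSpace X]
    {μ : Measure X} {h : ℕ → X → ℝ} {H : X → ℝ} (hh : ∀ j, Integrable (h j) μ)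
    (hH : Integrable H μ) (hh0 : ∀ j, ∀ᵐ x ∂μ, 0 ≤ h j x) (hH0 : ∀ᵐ x ∂μ, 0 ≤ H x)
    (hlim : ∀ᵐ x ∂μ, Tendsto (fun j => h j x) atTop (𝓝 (H x)))
    (hint : Tendsto (fun j => ∫ x, h j x ∂μ) atTop (𝓝 (∫ x, H x ∂μ))) :
    Tendsto (fun j => ∫ x, |h j x - H x| ∂μ) atTop (𝓝 0) := by
  -- The identity behind the proof is `|h - H| = (h - H) + 2 (H - h)⁺`. The first term has vanishing
  -- integral in the limit and the second is dominated by `H`.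
  have hm : Tendsto (fun j => ∫ x, max (H x - h j x) 0 ∂μ) atTop (𝓝 0) := by
    have : Tendsto (fun j => ∫ x, max (H x - h j x) 0 ∂μ) atTop (𝓝 (∫ _, (0 : ℝ) ∂μ)) := by
      refine tendsto_integral_of_dominated_convergence H
        (fun j => ((hH.sub (hh j)).pos_part).aestronglyMeasurable) hH (fun j => ?_) ?_
      · filter_upwards [hh0 j, hH0] with x h0 h1
        rw [Real.norm_of_nonneg (le_max_right _ _)]
        exact max_le (by linarith) h1
      · filter_upwards [hlim] with x hx
        have := (tendsto_const_nhds (x := H x)).sub hx |>.max (tendsto_const_nhds (x := (0 : ℝ)))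
        simpa using this
    simpa using this
  have key : ∀ j, ∫ x, |h j x - H x| ∂μ =
      (∫ x, h j x ∂μ - ∫ x, H x ∂μ) + 2 * ∫ x, max (H x - h j x) 0 ∂μ := by
    intro j
    have h1 : Integrable (fun x => h j x - H x) μ := (hh j).sub hH
    have h2 : Integrable (fun x => 2 * max (H x - h j x) 0) μ :=
      ((hH.sub (hh j)).pos_part).const_mul 2
    rw [← integral_sub (hh j) hH, ← integral_const_mul, ← integral_add h1 h2]
    congr 1; ext x
    rcases le_total (h j x) (H x) with h1 | h1
    · rw [abs_of_nonpos (by linarith), max_eq_left (by linarith)]; ring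
    · rw [abs_of_nonneg (by linarith), max_eq_right (by linarith)]; ring
  simp only [key]
  simpa using (hint.sub_const (∫ x, H x ∂μ)).add (hm.const_mul 2)

/-! ### Mollification -/

/-- A radial bump function supported in the ball of radius `1 / (j + 1)`. -/
def mollifierBump (n j : ℕ) : ContDiffBump (0 : Euc n) where
  rIn := 1 / ((j : ℝ) + 1) / 2
  rOut := 1 / ((j : ℝ) + 1)
  rIn_pos := by positivity
  rIn_lt_rOut := half_lt_self (by positivity)

/-- The mollifier of radius `1 / (j + 1)`. -/
def mollifier (n j : ℕ) : Euc n → ℝ := (mollifierBump n j).normed volume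

/-- The mollification of `f` at scale `1 / (j + 1)`. -/
def mollify {n : ℕ} {E : Type*} [NormedAddCommGroup E] [NormedSpace ℝ E] (j : ℕ)
    (f : Euc n → E) (x : Euc n) : E :=
  ∫ y, mollifier n j (x - y) • f y

section Mollifier

variable {n : ℕ} (j : ℕ)

theorem mollifier_nonneg (x : Euc n) : 0 ≤ mollifier n j x := (mollifierBump n j).nonneg_normed x

theorem contDiff_mollifier : ContDiff ℝ ∞ (mollifier n j) := (mollifierBump n j).contDiff_normed

theorem continuous_mollifier : Continuous (mollifier n j) := (mollifierBump n j).continuous_normed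

theorem hasCompactSupport_mollifier : HasCompactSupport (mollifier n j) :=
  (mollifierBump n j).hasCompactSupport_normed

theorem integral_mollifier : ∫ x, mollifier n j x = 1 := (mollifierBump n j).integral_normed

theorem integrable_mollifier : Integrable (mollifier n j) := (mollifierBump n j).integrable_normed

theorem mollifier_eq_zero {x : Euc n} (hx : 1 / ((j : ℝ) + 1) ≤ ‖x‖) : mollifier n j x = 0 := by
  rw [mollifier, ContDiffBump.normed_def, ContDiffBump.zero_of_le_dist _ (by simpa [mollifierBump] using hx),
    zero_div]

theorem integral_mollifier_sub (x : Euc n) : ∫ y, mollifier n j (x - y) = 1 := by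
  rw [integral_sub_left_eq_self (mollifier n j) volume x, integral_mollifier]

/-- The ratio of outer to inner radius is always two, so all the bumps are dilations of a single
profile. This makes the exact scaling of the gradient available. -/
theorem mollifierBump_apply (x : Euc n) :
    mollifierBump n j x = mollifierBump n 0 (((j : ℝ) + 1) • x) := by
  have h : ((j : ℝ) + 1) ≠ 0 := by positivity
  rw [ContDiffBump.apply, ContDiffBump.apply]
  simp only [mollifierBump, sub_zero, smul_smul]
  congr 1
  · field_simp
  · congr 1
    field_simp
    simp

/-- Dilating by `R = j + 1` multiplies the gradient by `R`, while the Jacobians in the normalisation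
and in the integral cancel. -/
theorem exists_integral_norm_fderiv_mollifier_le (n : ℕ) :
    ∃ C : ℝ, 0 ≤ C ∧ ∀ j, ∫ x, ‖fderiv ℝ (mollifier n j) x‖ ≤ C * ((j : ℝ) + 1) := by
  refine ⟨(∫ x, mollifierBump n 0 x)⁻¹ * ∫ x, ‖fderiv ℝ (mollifierBump n 0) x‖,
    mul_nonneg (inv_nonneg.2 (mollifierBump n 0).integral_pos.le)
      (integral_nonneg fun _ => norm_nonneg _), fun j => ?_⟩
  have hj : (0 : ℝ) < (j : ℝ) + 1 := by positivity
  set R : ℝ := (j : ℝ) + 1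
  have h1 : (mollifierBump n j : Euc n → ℝ) = fun x => mollifierBump n 0 (R • x) :=
    funext fun x => mollifierBump_apply j x
  have h2 : ∫ x, mollifierBump n j x = |(R ^ n)⁻¹| * ∫ x, mollifierBump n 0 x := by
    rw [h1, Measure.integral_comp_smul volume (mollifierBump n 0 : Euc n → ℝ) R]
    simp
  have h3 : ∀ x, ‖fderiv ℝ (mollifier n j) x‖ =
      (∫ x, mollifierBump n j x)⁻¹ * (R * ‖fderiv ℝ (mollifierBump n 0) (R • x)‖) := by
    intro x
    have e : mollifier n j = fun x => (∫ x, mollifierBump n j x)⁻¹ • mollifierBump n j x := by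
      ext x
      rw [mollifier, ContDiffBump.normed_def, smul_eq_mul, div_eq_inv_mul]
    rw [e, fderiv_fun_const_smul ((mollifierBump n j).contDiff.differentiable one_ne_zero x),
      norm_smul, h1, fderiv_comp_smul, norm_smul, Real.norm_of_nonneg hj.le, norm_inv,
      Real.norm_of_nonneg (integral_nonneg fun x => (mollifierBump n 0).nonneg' _)]
  simp only [h3]
  rw [integral_const_mul, integral_const_mul,
    Measure.integral_comp_smul volume (fun x => ‖fderiv ℝ (mollifierBump n 0) x‖) R, h2]
  have h4 : |(R ^ n)⁻¹| ≠ 0 := by positivity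
  have h5 : ∫ x, mollifierBump n 0 x ≠ 0 := (mollifierBump n 0).integral_pos.ne'
  simp only [finrank_euclideanSpace, Fintype.card_fin, smul_eq_mul]
  apply le_of_eq
  field_simp

end Mollifier

section Mollify

variable {n : ℕ} {E : Type*} [NormedAddCommGroup E] [NormedSpace ℝ E]

open scoped Convolution in
theorem mollify_eq_convolution (j : ℕ) (f : Euc n → E) :
    mollify j f = (mollifier n j ⋆[ContinuousLinearMap.lsmul ℝ ℝ, volume] f) := by
  ext x
  rw [convolution_eq_swap]
  rfl

theorem integrable_mollifier_smul (j : ℕ) {f : Euc n → E} (hf : Integrable f) (x : Euc n) :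
    Integrable (fun y => mollifier n j (x - y) • f y) := by
  obtain ⟨M, hM⟩ := (hasCompactSupport_mollifier (n := n) j).exists_norm_le
    (continuous_mollifier j)
  refine hf.bdd_smul M ?_ (ae_of_all _ fun y => hM _)
  exact ((continuous_mollifier j).comp (continuous_const.sub continuous_id)).aestronglyMeasurable

theorem integrable_mollify (j : ℕ) {f : Euc n → E} (hf : Integrable f) :
    Integrable (mollify j f) := by
  rw [mollify_eq_convolution]
  exact (integrable_mollifier j).integrable_convolution _ hf

theorem integral_mollify [CompleteSpace E] (j : ℕ) {f : Euc n → E} (hf : Integrable f) :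
    ∫ x, mollify j f x = ∫ x, f x := by
  rw [mollify_eq_convolution, integral_convolution _ (integrable_mollifier j) hf,
    integral_mollifier]
  simp

theorem norm_mollify_le (j : ℕ) (f : Euc n → E) (x : Euc n) :
    ‖mollify j f x‖ ≤ mollify j (fun y => ‖f y‖) x := by
  refine (norm_integral_le_integral_norm _).trans (le_of_eq ?_)
  simp only [mollify, norm_smul, Real.norm_of_nonneg (mollifier_nonneg j _), smul_eq_mul]

theorem mollify_nonneg (j : ℕ) {f : Euc n → ℝ} (x : Euc n)
    (h : ∀ᵐ y ∂(volume : Measure (Euc n)), 0 ≤ f y) : 0 ≤ mollify j f x := by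
  refine integral_nonneg_of_ae ?_
  filter_upwards [h] with y hy
  exact mul_nonneg (mollifier_nonneg j _) hy

/-- A mollification is an average over a small ball, so a bound is needed only there. This locality
yields the supremum estimate in terms of a neighbourhood. -/
theorem mollify_le_of_ae_le (j : ℕ) {f : Euc n → ℝ} (hf : Integrable f) {M : ℝ} (x : Euc n)
    (h : ∀ᵐ y ∂(volume : Measure (Euc n)), ‖x - y‖ < 1 / ((j : ℝ) + 1) → f y ≤ M) :
    mollify j f x ≤ M := by
  have h1 : Integrable (fun y => mollifier n j (x - y) * M) :=
    ((integrable_mollifier j).comp_sub_left x).mul_const M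
  calc mollify j f x ≤ ∫ y, mollifier n j (x - y) * M := by
        refine integral_mono_ae (integrable_mollifier_smul j hf x) h1 ?_
        filter_upwards [h] with y hy
        by_cases hxy : ‖x - y‖ < 1 / ((j : ℝ) + 1)
        · exact mul_le_mul_of_nonneg_left (hy hxy) (mollifier_nonneg j _)
        · simp [mollifier_eq_zero j (not_lt.1 hxy)]
    _ = M := by rw [integral_mul_const, integral_mollifier_sub, one_mul]

theorem ae_tendsto_mollify [CompleteSpace E] {f : Euc n → E} (hf : Integrable f) :
    ∀ᵐ x, Tendsto (fun j => mollify j f x) atTop (𝓝 (f x)) := by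
  -- `K = 2` bounds the ratio of the outer to the inner radius, the condition under which Lebesgue
  -- differentiation applies to these kernels.
  have := ContDiffBump.ae_convolution_tendsto_right_of_locallyIntegrable
    (φ := mollifierBump n) (l := atTop) (K := 2) tendsto_one_div_add_atTop_nhds_zero_nat
    (Eventually.of_forall fun j => by simp only [mollifierBump]; linarith) hf.locallyIntegrable
  filter_upwards [this] with x hx
  simp only [mollify_eq_convolution]
  exact hx

/-- Mollification preserves the integral and the sign and converges almost everywhere, so Scheffé's
lemma applies. -/
theorem tendsto_integral_abs_mollify_sub {h : Euc n → ℝ} (hh : Integrable h)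
    (h0 : ∀ᵐ x, 0 ≤ h x) :
    Tendsto (fun j => ∫ x, |mollify j h x - h x|) atTop (𝓝 0) := by
  refine tendsto_integral_abs_sub_of_tendsto_integral (fun j => integrable_mollify j hh) hh
    (fun j => ae_of_all _ fun x => mollify_nonneg j x h0) h0 (ae_tendsto_mollify hh) ?_
  simp only [integral_mollify _ hh]
  exact tendsto_const_nhds

/-- The error is dominated by the mollification of `‖f‖` plus `‖f‖`, and these majorants converge in
`L¹` by the nonnegative scalar case. -/
theorem tendsto_integral_norm_mollify_sub [CompleteSpace E] {f : Euc n → E} (hf : Integrable f) :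
    Tendsto (fun j => ∫ x, ‖mollify j f x - f x‖) atTop (𝓝 0) := by
  refine tendsto_integral_zero_of_le_of_tendsto_L1
    (h := fun j x => mollify j (fun y => ‖f y‖) x + ‖f x‖) (H := fun x => ‖f x‖ + ‖f x‖)
    (fun j => ((integrable_mollify j hf).sub hf).norm.aestronglyMeasurable)
    (fun j => ae_of_all _ fun x => norm_nonneg _)
    (fun j => ae_of_all _ fun x =>
      (norm_sub_le _ _).trans (add_le_add (norm_mollify_le j f x) le_rfl))
    (fun j => (integrable_mollify j hf.norm).add hf.norm) (hf.norm.add hf.norm) ?_ ?_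
  · filter_upwards [ae_tendsto_mollify hf] with x hx
    simpa using (hx.sub_const (f x)).norm
  · simpa using tendsto_integral_abs_mollify_sub hf.norm (ae_of_all _ fun x => norm_nonneg _)

end Mollify

/-! ### Gradients of mollifications -/

section MollifySmooth

variable {n : ℕ}

theorem contDiff_mollify (j : ℕ) {f : Euc n → ℝ} (hf : Integrable f) :
    ContDiff ℝ ∞ (mollify j f) := by
  rw [mollify_eq_convolution]
  exact (hasCompactSupport_mollifier j).contDiff_convolution_left _ (contDiff_mollifier j)
    hf.locallyIntegrable

theorem hasCompactSupport_mollify (j : ℕ) {f : Euc n → ℝ} (hf : HasCompactSupport f) :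
    HasCompactSupport (mollify j f) := by
  rw [mollify_eq_convolution]
  exact (hasCompactSupport_mollifier j).convolution _ hf

theorem integrable_smul_fderiv_mollifier (j : ℕ) {f : Euc n → ℝ} (hf : Integrable f)
    (x : Euc n) : Integrable (fun y => f y • fderiv ℝ (mollifier n j) (x - y)) := by
  have hc : Continuous (fderiv ℝ (mollifier n j)) :=
    (contDiff_mollifier j).continuous_fderiv (by simp)
  obtain ⟨M, hM⟩ := ((hasCompactSupport_mollifier (n := n) j).fderiv ℝ).exists_norm_le hc
  exact hf.smul_bdd M
    (hc.comp (continuous_const.sub continuous_id)).aestronglyMeasurable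
    (ae_of_all _ fun y => hM _)

open scoped Convolution in
theorem fderiv_mollify (j : ℕ) {f : Euc n → ℝ} (hf : Integrable f) (x : Euc n) :
    fderiv ℝ (mollify j f) x = ∫ y, f y • fderiv ℝ (mollifier n j) (x - y) := by
  have e : mollify j f = (f ⋆[ContinuousLinearMap.mul ℝ ℝ, volume] mollifier n j) := by
    ext z
    simp only [mollify, convolution_def, ContinuousLinearMap.mul_apply', smul_eq_mul, mul_comm]
  have h := (hasCompactSupport_mollifier j).hasFDerivAt_convolution_right
    (ContinuousLinearMap.mul ℝ ℝ) hf.locallyIntegrable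
    ((contDiff_mollifier (n := n) j).of_le (by simp)) x
  rw [e, h.fderiv, convolution_def]
  congr 1

/-- All derivatives fall on the mollifier, so only the sup of `f` enters. The growth in `j + 1`, the
reciprocal of the radius, is what the Hölder decay of the coefficient has to compensate later. -/
theorem exists_norm_gradient_mollify_le (n : ℕ) :
    ∃ C : ℝ, 0 ≤ C ∧ ∀ (j : ℕ) (f : Euc n → ℝ) (M : ℝ), Integrable f → (∀ y, |f y| ≤ M) →
      ∀ x, ‖gradient (mollify j f) x‖ ≤ C * M * ((j : ℝ) + 1) := by
  obtain ⟨C, hC0, hC⟩ := exists_integral_norm_fderiv_mollifier_le n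
  refine ⟨C, hC0, fun j f M hf hM x => ?_⟩
  have hM0 : 0 ≤ M := (abs_nonneg _).trans (hM 0)
  have hI : Integrable (fun y => ‖fderiv ℝ (mollifier n j) y‖) :=
    (((contDiff_mollifier j).continuous_fderiv (by simp)).integrable_of_hasCompactSupport
      ((hasCompactSupport_mollifier j).fderiv ℝ)).norm
  rw [norm_gradient_eq_norm_fderiv, fderiv_mollify j hf]
  calc ‖∫ y, f y • fderiv ℝ (mollifier n j) (x - y)‖
      ≤ ∫ y, ‖f y • fderiv ℝ (mollifier n j) (x - y)‖ := norm_integral_le_integral_norm _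
    _ ≤ ∫ y, M * ‖fderiv ℝ (mollifier n j) (x - y)‖ := by
        refine integral_mono (integrable_smul_fderiv_mollifier j hf x).norm
          ((hI.comp_sub_left x).const_mul M) fun y => ?_
        simp only [norm_smul, Real.norm_eq_abs]
        gcongr
        exact hM y
    _ = M * ∫ y, ‖fderiv ℝ (mollifier n j) y‖ := by
        rw [integral_const_mul,
          integral_sub_left_eq_self (fun y => ‖fderiv ℝ (mollifier n j) y‖) volume x]
    _ ≤ M * (C * ((j : ℝ) + 1)) := by gcongr; exact hC j
    _ = _ := by ring

/-- When the ball around `x` lies in `V`, the reflected mollifier `y ↦ mollifier n j (x - y)` is an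
admissible test function for the weak gradient. Extension by zero outside `V` is then invisible at
`x`. -/
theorem IsWeakGrad.gradient_mollify_indicator {V : Set (Euc n)} (hV : MeasurableSet V)
    {f : Euc n → ℝ} {F : Euc n → Euc n} (h : IsWeakGrad V f F) (hf : IntegrableOn f V)
    (hF : IntegrableOn F V) (j : ℕ) {x : Euc n}
    (hx : Metric.closedBall x (1 / ((j : ℝ) + 1)) ⊆ V) :
    gradient (mollify j (V.indicator f)) x = mollify j (V.indicator F) x := by
  have hfi : Integrable (V.indicator f) := (integrable_indicator_iff hV).2 hf
  have hFi : Integrable (V.indicator F) := (integrable_indicator_iff hV).2 hF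
  ext i
  set φ : Euc n → ℝ := fun y => mollifier n j (x - y) with hφ
  have hφd : ContDiff ℝ ∞ φ := (contDiff_mollifier j).comp (contDiff_const.sub contDiff_id)
  have hφs : tsupport φ ⊆ Metric.closedBall x (1 / ((j : ℝ) + 1)) := by
    refine closure_minimal (fun y hy => ?_) Metric.isClosed_closedBall
    rw [Metric.mem_closedBall, dist_comm, dist_eq_norm]
    by_contra hlt
    exact hy (mollifier_eq_zero j (not_le.1 hlt).le)
  have hφc : HasCompactSupport φ :=
    (isCompact_closedBall _ _).of_isClosed_subset (isClosed_tsupport _) hφs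
  have hder : ∀ y v, fderiv ℝ φ y v = - fderiv ℝ (mollifier n j) (x - y) v := by
    intro y v
    have h1 : HasFDerivAt φ ((fderiv ℝ (mollifier n j) (x - y)).comp
        (-(ContinuousLinearMap.id ℝ (Euc n)))) y :=
      (((contDiff_mollifier j).differentiable (by simp) (x - y)).hasFDerivAt).comp y
        ((hasFDerivAt_id y).const_sub x)
    rw [h1.fderiv]
    simp
  have hp := h.parts φ hφd hφc (hφs.trans hx) i
  rw [gradient_apply_eq_fderiv_single, fderiv_mollify j hfi,
    ContinuousLinearMap.integral_apply (integrable_smul_fderiv_mollifier j hfi x)]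
  have e1 : ∫ y, (V.indicator f y • fderiv ℝ (mollifier n j) (x - y)) (EuclideanSpace.single i 1)
      = - ∫ y in V, f y * fderiv ℝ φ y (EuclideanSpace.single i 1) := by
    rw [← integral_indicator hV, ← integral_neg]
    congr 1; ext y
    by_cases hy : y ∈ V <;> simp [hy, hder]
  have e2 : mollify j (V.indicator F) x i = ∫ y in V, F y i * φ y := by
    have h3 := (EuclideanSpace.proj (𝕜 := ℝ) i).integral_comp_comm
      (integrable_mollifier_smul j hFi x)
    have h4 : mollify j (V.indicator F) x i =
      ∫ y, (EuclideanSpace.proj (𝕜 := ℝ) i) (mollifier n j (x - y) • V.indicator F y) := h3.symm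
    rw [h4, ← integral_indicator hV]
    congr 1; ext y
    by_cases hy : y ∈ V <;> simp [hy, hφ, mul_comm]
  rw [e1, hp, e2, neg_neg]

end MollifySmooth

end

noncomputable section

/-! ### The chain rule for weak gradients -/

theorem tendsto_integral_of_norm_sub_le {X : Type*} [MeasurableSpace X] {μ : Measure X}
    {f b : ℕ → X → ℝ} {F : X → ℝ} (hf : ∀ j, Integrable (f j) μ) (hF : Integrable F μ)
    (hb : ∀ j, Integrable (b j) μ) (hle : ∀ j x, |f j x - F x| ≤ b j x)
    (hlim : Tendsto (fun j => ∫ x, b j x ∂μ) atTop (𝓝 0)) :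
    Tendsto (fun j => ∫ x, f j x ∂μ) atTop (𝓝 (∫ x, F x ∂μ)) := by
  rw [tendsto_iff_norm_sub_tendsto_zero]
  refine squeeze_zero (fun _ => norm_nonneg _) (fun j => ?_) hlim
  rw [← integral_sub (hf j) hF]
  exact norm_integral_le_of_norm_le (hb j) (ae_of_all _ (hle j))

/-- The classical chain rule holds for mollifications and passes to the limit. As `θ` is
1-Lipschitz, the function term converges in `L¹`. The gradient error splits into `θ'(U j) (W j -
D)`, small in `L¹`, and `(θ'(U j) - θ'(u)) D`, which tends to zero almost everywhere and is
dominated by `2 |D|`. The normalisation `θ 0 = 0` gives `|θ (u)| ≤ |u|`, hence integrability. -/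
theorem IsWeakGrad.comp_contDiff {n : ℕ} {V : Set (Euc n)} (hV : IsOpen V) {u : Euc n → ℝ}
    {D : Euc n → Euc n} (h : IsWeakGrad V u D) (hu : IntegrableOn u V) (hD : IntegrableOn D V)
    {θ : ℝ → ℝ} (hθ : ContDiff ℝ ∞ θ) (hθ0 : θ 0 = 0) (hθ' : ∀ t, |deriv θ t| ≤ 1) :
    IsWeakGrad V (fun x => θ (u x)) (fun x => deriv θ (u x) • D x) := by
  have hlip : ∀ s t, |θ s - θ t| ≤ |s - t| := by
    intro s t
    have := Convex.norm_image_sub_le_of_norm_deriv_le (f := θ) (C := 1) (s := univ) (x := t)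
      (y := s) (fun x _ => hθ.differentiable (by simp) x) (fun x _ => hθ' x) convex_univ
      (mem_univ _) (mem_univ _)
    simpa using this
  have hθle : ∀ t, |θ t| ≤ |t| := fun t => by simpa [hθ0] using hlip t 0
  have hθ'c : Continuous (deriv θ) := hθ.continuous_deriv (by simp)
  have hui : Integrable (V.indicator u) := (integrable_indicator_iff hV.measurableSet).2 hu
  have hDi : Integrable (V.indicator D) := (integrable_indicator_iff hV.measurableSet).2 hD
  have hθu : IntegrableOn (fun x => θ (u x)) V :=
    hu.norm.mono' (hθ.continuous.comp_aestronglyMeasurable hu.aestronglyMeasurable)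
      (ae_of_all _ fun x => hθle _)
  have hθD : IntegrableOn (fun x => deriv θ (u x) • D x) V :=
    hD.bdd_smul 1 (hθ'c.comp_aestronglyMeasurable hu.aestronglyMeasurable)
      (ae_of_all _ fun x => hθ' _)
  refine isWeakGrad_of_integral hθu.locallyIntegrableOn hθD.locallyIntegrableOn
    fun φ hφ hc hs i => ?_
  set U : ℕ → Euc n → ℝ := fun j => mollify j (V.indicator u) with hU
  set W : ℕ → Euc n → Euc n := fun j => mollify j (V.indicator D) with hW
  have hUc : ∀ j, ContDiff ℝ ∞ (U j) := fun j => contDiff_mollify j hui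
  have hUi : ∀ j, Integrable (U j) := fun j => integrable_mollify j hui
  have hWi : ∀ j, Integrable (W j) := fun j => integrable_mollify j hDi
  have hφ' : Continuous (fun x => fderiv ℝ φ x (EuclideanSpace.single i 1)) :=
    (hφ.continuous_fderiv (by simp)).clm_apply continuous_const
  obtain ⟨B, hB⟩ := (hc.fderiv_apply ℝ (EuclideanSpace.single i 1)).exists_norm_le hφ'
  obtain ⟨A, hA⟩ := hc.exists_norm_le hφ.continuous
  have hA0 : 0 ≤ A := (norm_nonneg _).trans (hA 0)
  -- the identity for the mollified functions
  have hev : ∀ᶠ j in atTop, ∫ x, θ (U j x) * fderiv ℝ φ x (EuclideanSpace.single i 1) =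
      - ∫ x, (deriv θ (U j x) * W j x i) * φ x := by
    -- Once the radius is below the margin between the support of `φ` and the complement of `V`, the
    -- gradient of `U j` equals `W j` wherever `φ` does not vanish.
    obtain ⟨δ, hδ, hδV⟩ := hc.isCompact.exists_cthickening_subset_open hV hs
    have hsmall : ∀ᶠ j : ℕ in atTop, 1 / ((j : ℝ) + 1) < δ :=
      tendsto_one_div_add_atTop_nhds_zero_nat.eventually (gt_mem_nhds hδ)
    filter_upwards [hsmall] with j hj
    have h1 := ((hθ.comp (hUc j)).isWeakGrad univ).integral_mul_fderiv hφ hc (subset_univ _) i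
    refine h1.trans ?_
    congr 2; ext x
    by_cases hx : x ∈ tsupport φ
    · have hball : Metric.closedBall x (1 / ((j : ℝ) + 1)) ⊆ V :=
        ((Metric.closedBall_subset_closedBall hj.le).trans
          (Metric.closedBall_subset_cthickening hx δ)).trans hδV
      have h2 := h.gradient_mollify_indicator hV.measurableSet hu hD j hball
      have h3 : HasFDerivAt (θ ∘ U j) (deriv θ (U j x) • fderiv ℝ (U j) x) x :=
        (hθ.differentiable (by simp) (U j x)).hasDerivAt.comp_hasFDerivAt x
          ((hUc j).differentiable (by simp) x).hasFDerivAt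
      rw [gradient_apply_eq_fderiv_single, h3.fderiv, hW]
      simp only [← h2, gradient_apply_eq_fderiv_single]
      simp [hU]
    · simp [image_eq_zero_of_notMem_tsupport hx]
  have hLHS : Tendsto (fun j => ∫ x, θ (U j x) * fderiv ℝ φ x (EuclideanSpace.single i 1)) atTop
      (𝓝 (∫ x, θ (V.indicator u x) * fderiv ℝ φ x (EuclideanSpace.single i 1))) := by
    have hint : ∀ f : Euc n → ℝ, Integrable f →
        Integrable fun x => θ (f x) * fderiv ℝ φ x (EuclideanSpace.single i 1) := fun f hf => by
      refine Integrable.mul_bdd (c := B) ?_ hφ'.aestronglyMeasurable (ae_of_all _ hB)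
      exact hf.norm.mono' (hθ.continuous.comp_aestronglyMeasurable hf.aestronglyMeasurable)
        (ae_of_all _ fun x => hθle _)
    refine tendsto_integral_of_norm_sub_le (b := fun j x => ‖U j x - V.indicator u x‖ * B)
      (fun j => hint _ (hUi j)) (hint _ hui) (fun j => ((hUi j).sub hui).norm.mul_const B)
      (fun j x => ?_) ?_
    · rw [← sub_mul, abs_mul]
      exact mul_le_mul (hlip _ _) (hB x) (abs_nonneg _) (norm_nonneg _)
    · simp only [integral_mul_const]
      simpa using (tendsto_integral_norm_mollify_sub hui).mul_const B
  have hRHS : Tendsto (fun j => ∫ x, (deriv θ (U j x) * W j x i) * φ x) atTop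
      (𝓝 (∫ x, (deriv θ (V.indicator u x) * V.indicator D x i) * φ x)) := by
    have hint : ∀ (f : Euc n → ℝ) (G : Euc n → Euc n), Integrable f → Integrable G →
        Integrable fun x => (deriv θ (f x) * G x i) * φ x := fun f G hf hG => by
      refine Integrable.mul_bdd (c := A) ?_ hφ.continuous.aestronglyMeasurable (ae_of_all _ hA)
      exact Integrable.bdd_mul (c := 1) ((EuclideanSpace.proj (𝕜 := ℝ) i).integrable_comp hG)
        (hθ'c.comp_aestronglyMeasurable hf.aestronglyMeasurable) (ae_of_all _ fun x => hθ' _)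
    have hdm : ∀ j, AEStronglyMeasurable
        (fun x => |deriv θ (U j x) - deriv θ (V.indicator u x)| * ‖V.indicator D x‖) := fun j =>
      (((hθ'c.comp_aestronglyMeasurable (hUi j).aestronglyMeasurable).sub
        (hθ'c.comp_aestronglyMeasurable hui.aestronglyMeasurable)).norm).mul
        hDi.aestronglyMeasurable.norm
    have hdb : ∀ j x, ‖|deriv θ (U j x) - deriv θ (V.indicator u x)| * ‖V.indicator D x‖‖ ≤
        2 * ‖V.indicator D x‖ := fun j x => by
      rw [Real.norm_of_nonneg (by positivity)]
      gcongr
      exact (abs_sub _ _).trans (by linarith [hθ' (U j x), hθ' (V.indicator u x)])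
    have hdi : ∀ j, Integrable
        (fun x => |deriv θ (U j x) - deriv θ (V.indicator u x)| * ‖V.indicator D x‖) := fun j =>
      (hDi.norm.const_mul 2).mono' (hdm j) (ae_of_all _ (hdb j))
    refine tendsto_integral_of_norm_sub_le
      (b := fun j x => (‖W j x - V.indicator D x‖ +
        |deriv θ (U j x) - deriv θ (V.indicator u x)| * ‖V.indicator D x‖) * A)
      (fun j => hint _ _ (hUi j) (hWi j)) (hint _ _ hui hDi)
      (fun j => (((hWi j).sub hDi).norm.add (hdi j)).mul_const A) (fun j x => ?_) ?_
    · rw [← sub_mul, abs_mul]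
      refine mul_le_mul ?_ (hA x) (abs_nonneg _) (by positivity)
      have e : deriv θ (U j x) * W j x i - deriv θ (V.indicator u x) * V.indicator D x i =
          deriv θ (U j x) * (W j x - V.indicator D x) i +
            (deriv θ (U j x) - deriv θ (V.indicator u x)) * V.indicator D x i := by
        simp only [PiLp.sub_apply]; ring
      rw [e]
      refine (abs_add_le _ _).trans (add_le_add ?_ ?_)
      · rw [abs_mul]
        exact (mul_le_of_le_one_left (abs_nonneg _) (hθ' _)).trans
          (PiLp.norm_apply_le (W j x - V.indicator D x) i)
      · rw [abs_mul]
        gcongr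
        exact PiLp.norm_apply_le (V.indicator D x) i
    · have h1 : Tendsto (fun j => ∫ x, |deriv θ (U j x) - deriv θ (V.indicator u x)| *
          ‖V.indicator D x‖) atTop (𝓝 (∫ _ : Euc n, (0 : ℝ))) := by
        refine tendsto_integral_of_dominated_convergence _ hdm (hDi.norm.const_mul 2)
          (fun j => ae_of_all _ (hdb j)) ?_
        filter_upwards [ae_tendsto_mollify hui] with x hx
        have h2 : Tendsto (fun j => deriv θ (U j x)) atTop (𝓝 (deriv θ (V.indicator u x))) :=
          (hθ'c.tendsto _).comp hx
        simpa using ((h2.sub_const (deriv θ (V.indicator u x))).abs).mul_const ‖V.indicator D x‖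
      have h3 : ∀ j, ∫ x, (‖W j x - V.indicator D x‖ +
          |deriv θ (U j x) - deriv θ (V.indicator u x)| * ‖V.indicator D x‖) * A =
          ((∫ x, ‖W j x - V.indicator D x‖) + ∫ x, |deriv θ (U j x) - deriv θ (V.indicator u x)| *
            ‖V.indicator D x‖) * A := fun j => by
        rw [integral_mul_const, integral_add _ (hdi j)]
        exact ((hWi j).sub hDi).norm
      simp only [h3]
      simpa using ((tendsto_integral_norm_mollify_sub hDi).add h1).mul_const A
  have hlim := tendsto_nhds_unique (hLHS.congr' hev) hRHS.neg
  have e1 : ∫ x, θ (u x) * fderiv ℝ φ x (EuclideanSpace.single i 1) =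
      ∫ x, θ (V.indicator u x) * fderiv ℝ φ x (EuclideanSpace.single i 1) := by
    congr 1; ext x
    by_cases hx : x ∈ V
    · simp [hx]
    · have : x ∉ tsupport (fun x => fderiv ℝ φ x (EuclideanSpace.single i 1)) :=
        fun h' => hx (hs (tsupport_fderiv_apply_subset ℝ _ h'))
      simp [image_eq_zero_of_notMem_tsupport this]
  have e2 : ∫ x, (deriv θ (u x) • D x) i * φ x =
      ∫ x, (deriv θ (V.indicator u x) * V.indicator D x i) * φ x := by
    congr 1; ext x
    by_cases hx : x ∈ V
    · simp [hx]
    · simp [image_eq_zero_of_notMem_tsupport fun h' => hx (hs h')]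
  rw [e1, e2, hlim]

end

noncomputable section

/-! ### The double phase modular -/

/-- The modified growth function `t (g⁺(t) + 1)`. -/
def modPhi (g : ℝ → ℝ) (t : ℝ) : ℝ := t * (max 0 (g (max t 0)) + 1)

/-- The modular density `t (g⁺(t) + 1) + c t^q` with coefficient `c`. -/
def modDensity (g : ℝ → ℝ) (q c t : ℝ) : ℝ := modPhi g t + c * t ^ q

section Growth

variable {g : ℝ → ℝ}

theorem IsGrowthFunction.continuous_modPhi (hg : IsGrowthFunction g) : Continuous (modPhi g) := by
  have h1 : Continuous fun t : ℝ => g (max t 0) :=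
    hg.cont.comp_continuous (continuous_id.max continuous_const) fun t =>
      mem_Ici.2 (le_max_right _ _)
  exact continuous_id.mul ((continuous_const.max h1).add continuous_const)

@[simp] theorem modPhi_zero (g : ℝ → ℝ) : modPhi g 0 = 0 := by simp [modPhi]

theorem modPhi_of_nonneg {t : ℝ} (ht : 0 ≤ t) : modPhi g t = t * (max 0 (g t) + 1) := by
  rw [modPhi, max_eq_left ht]

/-- This is the purpose of the summand one in `modPhi`: the modular controls the `L¹` norm of
gradients. -/
theorem le_modPhi {t : ℝ} (ht : 0 ≤ t) : t ≤ modPhi g t := by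
  rw [modPhi_of_nonneg ht]
  exact le_mul_of_one_le_right ht (by linarith [le_max_left 0 (g t)])

theorem modPhi_nonneg {t : ℝ} (ht : 0 ≤ t) : 0 ≤ modPhi g t := ht.trans (le_modPhi ht)

theorem IsGrowthFunction.modPhi_mono (hg : IsGrowthFunction g) {s t : ℝ} (hs : 0 ≤ s)
    (hst : s ≤ t) : modPhi g s ≤ modPhi g t := by
  have ht : 0 ≤ t := hs.trans hst
  rw [modPhi_of_nonneg hs, modPhi_of_nonneg ht]
  have h : g s ≤ g t := hg.mono hs ht hst
  gcongr

/-- For `t ≥ 0` the positive part may be pulled out, `t g⁺(t) = max (0, t g(t))`, a supremum of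
convex functions. -/
theorem IsGrowthFunction.convexOn_modPhi (hg : IsGrowthFunction g) :
    ConvexOn ℝ (Ici 0) (modPhi g) := by
  have h1 : ConvexOn ℝ (Ici 0) ((fun _ : ℝ => (0 : ℝ)) ⊔ fun t => t * g t) :=
    (convexOn_const 0 (convex_Ici 0)).sup hg.convex
  refine (h1.add (convexOn_id (convex_Ici 0))).congr fun t ht => ?_
  have ht : 0 ≤ t := ht
  simp only [Pi.add_apply, Pi.sup_apply, id, modPhi_of_nonneg ht, mul_add, mul_one,
    mul_max_of_nonneg _ _ ht, mul_zero]

/-- Concavity on the segment from `0` to `2 * t`, taken at its midpoint. It makes the modular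
doubling. -/
theorem IsGrowthFunction.apply_two_mul_le (hg : IsGrowthFunction g) {t : ℝ} (ht : 0 ≤ t) :
    g (2 * t) ≤ 2 * g t + |g 0| := by
  have h := hg.concave.2 (self_mem_Ici (a := (0 : ℝ))) (mem_Ici.2 (by positivity : 0 ≤ 2 * t))
    (by norm_num : (0 : ℝ) ≤ 1 / 2) (by norm_num : (0 : ℝ) ≤ 1 / 2) (by norm_num)
  simp only [smul_eq_mul] at h
  rw [show (1 : ℝ) / 2 * 0 + 1 / 2 * (2 * t) = t by ring] at h
  linarith [neg_abs_le (g 0)]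

theorem IsGrowthFunction.modPhi_two_mul_le (hg : IsGrowthFunction g) {t : ℝ} (ht : 0 ≤ t) :
    modPhi g (2 * t) ≤ (4 + 2 * |g 0|) * modPhi g t := by
  rw [modPhi_of_nonneg ht, modPhi_of_nonneg (by positivity)]
  have h1 : max 0 (g (2 * t)) ≤ 2 * max 0 (g t) + |g 0| := by
    refine max_le (by positivity) ((hg.apply_two_mul_le ht).trans ?_)
    linarith [le_max_right 0 (g t)]
  have h2 : max 0 (g (2 * t)) + 1 ≤ (2 + |g 0|) * (max 0 (g t) + 1) := by
    nlinarith [le_max_left 0 (g t), abs_nonneg (g 0),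
      mul_nonneg (abs_nonneg (g 0)) (le_max_left 0 (g t))]
  calc 2 * t * (max 0 (g (2 * t)) + 1) ≤ 2 * t * ((2 + |g 0|) * (max 0 (g t) + 1)) := by gcongr
    _ = _ := by ring

theorem IsGrowthFunction.abs_mul_le_modPhi (hg : IsGrowthFunction g) {t : ℝ} (ht : 0 ≤ t) :
    |t * g t| ≤ (1 + |g 0|) * modPhi g t := by
  have h0 : g 0 ≤ g t := hg.mono self_mem_Ici ht ht
  rw [abs_mul, abs_of_nonneg ht, modPhi_of_nonneg ht]
  have h1 : |g t| ≤ (1 + |g 0|) * (max 0 (g t) + 1) := by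
    have h2 : |g t| ≤ max 0 (g t) + |g 0| := by
      refine abs_le.2 ⟨?_, ?_⟩
      · linarith [neg_abs_le (g 0), le_max_left 0 (g t)]
      · linarith [abs_nonneg (g 0), le_max_right 0 (g t)]
    nlinarith [le_max_left 0 (g t), mul_nonneg (abs_nonneg (g 0)) (le_max_left 0 (g t))]
  calc t * |g t| ≤ t * ((1 + |g 0|) * (max 0 (g t) + 1)) := by gcongr
    _ = _ := by ring

variable {q c : ℝ}

@[simp] theorem modDensity_zero (hq : 0 < q) : modDensity g q c 0 = 0 := by
  simp [modDensity, Real.zero_rpow hq.ne']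

theorem IsGrowthFunction.continuous_modDensity (hg : IsGrowthFunction g) (hq : 0 ≤ q) (c : ℝ) :
    Continuous (modDensity g q c) :=
  hg.continuous_modPhi.add (continuous_const.mul (Real.continuous_rpow_const hq))

theorem modDensity_nonneg (hc : 0 ≤ c) {t : ℝ} (ht : 0 ≤ t) : 0 ≤ modDensity g q c t :=
  add_nonneg (modPhi_nonneg ht) (mul_nonneg hc (Real.rpow_nonneg ht q))

theorem le_modDensity (hc : 0 ≤ c) {t : ℝ} (ht : 0 ≤ t) : t ≤ modDensity g q c t :=
  le_add_of_le_of_nonneg (le_modPhi ht) (mul_nonneg hc (Real.rpow_nonneg ht q))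

theorem IsGrowthFunction.modDensity_mono (hg : IsGrowthFunction g) (hq : 0 ≤ q) (hc : 0 ≤ c)
    {s t : ℝ} (hs : 0 ≤ s) (hst : s ≤ t) : modDensity g q c s ≤ modDensity g q c t := by
  unfold modDensity
  gcongr
  exact hg.modPhi_mono hs hst

theorem IsGrowthFunction.convexOn_modDensity (hg : IsGrowthFunction g) (hq : 1 ≤ q)
    (hc : 0 ≤ c) : ConvexOn ℝ (Ici 0) (modDensity g q c) :=
  hg.convexOn_modPhi.add ((convexOn_rpow hq).smul hc)

/-- The constant in the quasi-triangle inequality for `modDensity`. -/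
def modConst (g : ℝ → ℝ) (q : ℝ) : ℝ := 4 + 2 * |g 0| + 2 ^ q

theorem modConst_pos (g : ℝ → ℝ) (q : ℝ) : 0 < modConst g q := by
  unfold modConst; positivity

/-- Doubling applied to `s + t ≤ 2 * max s t`. The constant does not involve `c`, so the inequality
may be integrated with a variable coefficient. -/
theorem IsGrowthFunction.modDensity_add_le (hg : IsGrowthFunction g) (hq : 0 ≤ q) (hc : 0 ≤ c)
    {s t : ℝ} (hs : 0 ≤ s) (ht : 0 ≤ t) :
    modDensity g q c (s + t) ≤ modConst g q * (modDensity g q c s + modDensity g q c t) := by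
  have hmax : 0 ≤ max s t := le_max_of_le_left hs
  have h1 : modDensity g q c (s + t) ≤ modDensity g q c (2 * max s t) :=
    hg.modDensity_mono hq hc (by positivity) (by linarith [le_max_left s t, le_max_right s t])
  have h2 : modDensity g q c (2 * max s t) ≤ modConst g q * modDensity g q c (max s t) := by
    have hp := modPhi_nonneg (g := g) hmax
    have hr := Real.rpow_nonneg hmax q
    have h2q : (0 : ℝ) ≤ 2 ^ q := by positivity
    unfold modDensity modConst
    rw [Real.mul_rpow (by norm_num) hmax]
    nlinarith [hg.modPhi_two_mul_le hmax, mul_nonneg h2q hp,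
      mul_nonneg (mul_nonneg hc hr) (abs_nonneg (g 0)), mul_nonneg hc hr]
  have h3 : modDensity g q c (max s t) ≤ modDensity g q c s + modDensity g q c t := by
    rcases max_choice s t with h | h <;> rw [h]
    · linarith [modDensity_nonneg (g := g) (q := q) hc ht]
    · linarith [modDensity_nonneg (g := g) (q := q) hc hs]
  exact h1.trans (h2.trans (mul_le_mul_of_nonneg_left h3 (modConst_pos g q).le))

theorem IsGrowthFunction.modDensity_norm_add_le {n : ℕ} (hg : IsGrowthFunction g) (hq : 0 ≤ q)
    (hc : 0 ≤ c) (y z : Euc n) :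
    modDensity g q c ‖y + z‖ ≤
      modConst g q * (modDensity g q c ‖y‖ + modDensity g q c ‖z‖) :=
  (hg.modDensity_mono hq hc (norm_nonneg _) (norm_add_le y z)).trans
    (hg.modDensity_add_le hq hc (norm_nonneg _) (norm_nonneg _))

theorem IsGrowthFunction.modDensity_norm_sub_le {n : ℕ} (hg : IsGrowthFunction g) (hq : 0 ≤ q)
    (hc : 0 ≤ c) (y z : Euc n) :
    modDensity g q c ‖y - z‖ ≤
      modConst g q * (modDensity g q c ‖y‖ + modDensity g q c ‖z‖) := by
  simpa [sub_eq_add_neg] using hg.modDensity_norm_add_le hq hc y (-z)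

theorem IsGrowthFunction.abs_integrandG_le {n : ℕ} (hg : IsGrowthFunction g) {a : Euc n → ℝ}
    {x : Euc n} (ha : 0 ≤ a x) {t : ℝ} (ht : 0 ≤ t) :
    |integrandG g a q x t| ≤ (1 + |g 0|) * modDensity g q (a x) t := by
  have hr : 0 ≤ a x * t ^ q := mul_nonneg ha (Real.rpow_nonneg ht q)
  refine (abs_add_le _ _).trans ?_
  rw [abs_of_nonneg hr, modDensity, mul_add]
  exact add_le_add (hg.abs_mul_le_modPhi ht)
    (le_mul_of_one_le_left hr (by linarith [abs_nonneg (g 0)]))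

end Growth

/-! ### Comparison of the integrand with the modular density -/

section Integrand

variable {n : ℕ} {g : ℝ → ℝ} {L : Euc n → ℝ} {Λ : ℝ}

/-- Monotonicity gives `g⁺ ≤ g + |g 0|` on the half line, so the change from `g` to `g⁺ + 1` costs
only a linear term, integrable for a Sobolev function. The growth condition says nothing at `z = 0`;
there the constant `Λ * |L 0|` takes over. -/
theorem IsGrowthFunction.modDensity_le_integrandH (hg : IsGrowthFunction g) (hΛ : 1 ≤ Λ)
    (hL : ∀ z : Euc n, z ≠ 0 →
      1 / Λ * (‖z‖ * g ‖z‖) ≤ L z ∧ L z ≤ Λ * (‖z‖ * g ‖z‖) + Λ)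
    {q s : ℝ} (hq : 0 < q) {a : Euc n → ℝ} {x : Euc n} (ha : 0 ≤ a x) (z : Euc n) :
    modDensity g q (a x) ‖z‖ ≤
      Λ * integrandH L a s q x z + (|g 0| + 1) * ‖z‖ + Λ * |L 0| := by
  have hΛ0 : 0 < Λ := by linarith
  have h1 : a x * ‖z‖ ^ q ≤ Λ * (a x * (s ^ 2 + ‖z‖ ^ 2) ^ (q / 2)) := by
    have e : ‖z‖ ^ q = (‖z‖ ^ 2) ^ (q / 2) := by
      rw [← Real.rpow_natCast, ← Real.rpow_mul (norm_nonneg _)]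
      congr 1; push_cast; ring
    have h2 : (‖z‖ ^ 2) ^ (q / 2) ≤ (s ^ 2 + ‖z‖ ^ 2) ^ (q / 2) :=
      Real.rpow_le_rpow (by positivity) (by nlinarith [sq_nonneg s]) (by positivity)
    rw [e]
    exact (mul_le_mul_of_nonneg_left h2 ha).trans (le_mul_of_one_le_left (by positivity) hΛ)
  have h2 : modPhi g ‖z‖ ≤ Λ * L z + (|g 0| + 1) * ‖z‖ + Λ * |L 0| := by
    rcases eq_or_ne z 0 with rfl | hz
    · simp only [norm_zero, modPhi_zero, mul_zero, add_zero]
      nlinarith [neg_abs_le (L 0)]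
    · have h3 : ‖z‖ * g ‖z‖ ≤ Λ * L z := by
        have := mul_le_mul_of_nonneg_left (hL z hz).1 hΛ0.le
        rwa [← mul_assoc, mul_one_div, div_self hΛ0.ne', one_mul] at this
      have h4 : g 0 ≤ g ‖z‖ := hg.mono self_mem_Ici (norm_nonneg z) (norm_nonneg z)
      have h5 : max 0 (g ‖z‖) ≤ g ‖z‖ + |g 0| :=
        max_le (by linarith [neg_abs_le (g 0)]) (by linarith [abs_nonneg (g 0)])
      rw [modPhi_of_nonneg (norm_nonneg z)]
      have h6 := mul_le_mul_of_nonneg_left h5 (norm_nonneg z)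
      have h7 : 0 ≤ Λ * |L 0| := by positivity
      nlinarith
  unfold modDensity integrandH
  linarith

theorem IsGrowthFunction.exists_abs_integrandH_le (hg : IsGrowthFunction g) (hΛ : 1 ≤ Λ)
    (hL : ∀ z : Euc n, z ≠ 0 →
      1 / Λ * (‖z‖ * g ‖z‖) ≤ L z ∧ L z ≤ Λ * (‖z‖ * g ‖z‖) + Λ)
    {q s : ℝ} (hq : 0 < q) (a : Euc n → ℝ) :
    ∃ C : ℝ, 0 ≤ C ∧ ∀ x, 0 ≤ a x → ∀ z : Euc n,
      |integrandH L a s q x z| ≤ C * (modDensity g q (a x) ‖z‖ + 1 + a x) := by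
  have hΛ0 : 0 < Λ := by linarith
  set C₁ : ℝ := Λ * (1 + |g 0|) + Λ + |L 0|
  set C₂ : ℝ := 2 ^ (q / 2) * (1 + (s ^ 2) ^ (q / 2))
  have hC₁ : 0 ≤ C₁ := by positivity
  have hC₂ : 0 ≤ C₂ := by positivity
  have h1 : ∀ z : Euc n, |L z| ≤ C₁ * (modPhi g ‖z‖ + 1) := by
    intro z
    have hp := modPhi_nonneg (g := g) (norm_nonneg z)
    rcases eq_or_ne z 0 with rfl | hz
    · have : 0 ≤ Λ * (1 + |g 0|) + Λ := by positivity
      simp only [norm_zero, modPhi_zero, zero_add, mul_one, C₁]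
      linarith
    · obtain ⟨h2, h3⟩ := hL z hz
      have h4 := hg.abs_mul_le_modPhi (norm_nonneg z)
      have h5 : 1 / Λ ≤ Λ := (div_le_one hΛ0 |>.2 hΛ).trans hΛ
      have h6 : |1 / Λ * (‖z‖ * g ‖z‖)| ≤ Λ * |‖z‖ * g ‖z‖| := by
        rw [abs_mul, abs_of_nonneg (by positivity : 0 ≤ 1 / Λ)]
        gcongr
      have h7 : |L z| ≤ Λ * |‖z‖ * g ‖z‖| + Λ := by
        refine abs_le.2 ⟨?_, ?_⟩
        · linarith [neg_abs_le (1 / Λ * (‖z‖ * g ‖z‖))]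
        · have := mul_le_mul_of_nonneg_left (le_abs_self (‖z‖ * g ‖z‖)) hΛ0.le
          linarith
      have h8 := mul_le_mul_of_nonneg_left h4 hΛ0.le
      have h9 : 0 ≤ |L 0| * (modPhi g ‖z‖ + 1) := by positivity
      have h10 : 0 ≤ Λ * modPhi g ‖z‖ := by positivity
      have h11 : 0 ≤ Λ * (1 + |g 0|) := by positivity
      simp only [C₁]
      nlinarith
  have h2 : ∀ z : Euc n, (s ^ 2 + ‖z‖ ^ 2) ^ (q / 2) ≤ C₂ * (‖z‖ ^ q + 1) := by
    intro z
    have e : (‖z‖ ^ 2) ^ (q / 2) = ‖z‖ ^ q := by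
      rw [← Real.rpow_natCast, ← Real.rpow_mul (norm_nonneg _)]
      congr 1; push_cast; ring
    have h3 := Real.add_rpow_le_two_rpow_mul (sq_nonneg s) (sq_nonneg ‖z‖)
      (by positivity : 0 ≤ q / 2)
    rw [e] at h3
    have h4 : 0 ≤ ‖z‖ ^ q := by positivity
    have h5 : 0 ≤ (s ^ 2) ^ (q / 2) := by positivity
    refine h3.trans ?_
    rw [show C₂ * (‖z‖ ^ q + 1) =
      2 ^ (q / 2) * ((1 + (s ^ 2) ^ (q / 2)) * (‖z‖ ^ q + 1)) by simp only [C₂]; ring]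
    gcongr
    nlinarith
  refine ⟨C₁ + C₂, by positivity, fun x hx z => ?_⟩
  have hp := modPhi_nonneg (g := g) (norm_nonneg z)
  have hr : 0 ≤ ‖z‖ ^ q := by positivity
  have hs : 0 ≤ (s ^ 2 + ‖z‖ ^ 2) ^ (q / 2) := by positivity
  unfold integrandH modDensity
  refine (abs_add_le _ _).trans ?_
  rw [abs_of_nonneg (mul_nonneg hx hs)]
  have h3 := mul_le_mul_of_nonneg_left (h2 z) hx
  have h4 := h1 z
  have h5 : 0 ≤ C₁ * (a x * ‖z‖ ^ q + a x) := by positivity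
  have h6 : 0 ≤ C₂ * (modPhi g ‖z‖ + 1) := by positivity
  nlinarith

end Integrand

/-! ### Jensen's inequality for mollifications -/

section Jensen

variable {n : ℕ}

/-- The weight `mollifier n j (x - y)` is the density of a probability measure, so this is Jensen's
inequality for that measure. -/
theorem ConvexOn.map_mollify_le {E : Type*} [NormedAddCommGroup E] [NormedSpace ℝ E]
    [CompleteSpace E] {Ψ : E → ℝ} (hΨ : ConvexOn ℝ univ Ψ) (hΨc : Continuous Ψ) (j : ℕ)
    {F : Euc n → E} (hF : Integrable F) (x : Euc n)
    (hi : Integrable fun y => mollifier n j (x - y) • Ψ (F y)) :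
    Ψ (mollify j F x) ≤ mollify j (fun y => Ψ (F y)) x := by
  set k : Euc n → NNReal := fun y => Real.toNNReal (mollifier n j (x - y)) with hk
  have hkm : Measurable k := (measurable_real_toNNReal.comp
    ((continuous_mollifier j).comp (continuous_const.sub continuous_id)).measurable)
  have hkc : ∀ y, ((k y : NNReal) : ℝ) = mollifier n j (x - y) := fun y =>
    Real.coe_toNNReal _ (mollifier_nonneg j _)
  set ν : Measure (Euc n) := volume.withDensity fun y => (k y : ℝ≥0∞) with hν
  have hprob : IsProbabilityMeasure ν := by
    refine ⟨?_⟩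
    rw [hν, withDensity_apply _ MeasurableSet.univ, Measure.restrict_univ]
    have h1 := ofReal_integral_eq_lintegral_ofReal
      ((integrable_mollifier (n := n) j).comp_sub_left x)
      (ae_of_all _ fun y => mollifier_nonneg j _)
    rw [integral_mollifier_sub] at h1
    rw [← ENNReal.ofReal_one, h1]
    rfl
  have h1 : Integrable F ν := by
    rw [hν, integrable_withDensity_iff_integrable_smul hkm]
    simp only [NNReal.smul_def, hkc]
    exact integrable_mollifier_smul j hF x
  have h2 : Integrable (Ψ ∘ F) ν := by
    rw [hν, integrable_withDensity_iff_integrable_smul hkm]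
    simp only [NNReal.smul_def, hkc]
    exact hi
  have h3 := hΨ.map_integral_le hΨc.continuousOn isClosed_univ (ae_of_all _ fun _ => mem_univ _)
    h1 h2
  have e1 : ∫ y, F y ∂ν = mollify j F x := by
    rw [hν, integral_withDensity_eq_integral_smul hkm]
    simp only [mollify, NNReal.smul_def, hkc]
  have e2 : ∫ y, Ψ (F y) ∂ν = mollify j (fun y => Ψ (F y)) x := by
    rw [hν, integral_withDensity_eq_integral_smul hkm]
    simp only [mollify, NNReal.smul_def, hkc]
  rwa [e1, e2] at h3

end Jensen

end

noncomputable section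

/-! ### Convergence of mollifications in the modular -/

section Modular

variable {n : ℕ} {g : ℝ → ℝ} {a : Euc n → ℝ} {q : ℝ}

theorem continuousOn_of_abs_sub_le_rpow {V : Set (Euc n)} {A α : ℝ} (hα : 0 < α)
    (ha : ∀ x ∈ V, ∀ y ∈ V, |a x - a y| ≤ A * ‖x - y‖ ^ α) : ContinuousOn a V := by
  intro x hx
  rw [ContinuousWithinAt, tendsto_iff_norm_sub_tendsto_zero]
  have h1 : Tendsto (fun y : Euc n => A * ‖y - x‖ ^ α) (𝓝[V] x) (𝓝 0) := by
    have hc : Continuous fun y : Euc n => A * ‖y - x‖ ^ α :=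
      continuous_const.mul ((Real.continuous_rpow_const hα.le).comp
        (continuous_id.sub continuous_const).norm)
    have := (hc.tendsto x).mono_left (nhdsWithin_le_nhds (s := V))
    simpa [Real.zero_rpow hα.ne'] using this
  exact squeeze_zero' (Eventually.of_forall fun _ => norm_nonneg _)
    (eventually_nhdsWithin_of_forall fun y hy => ha y hy x hx) h1

theorem IsGrowthFunction.aestronglyMeasurable_modDensity (hg : IsGrowthFunction g) (hq : 0 ≤ q)
    {μ : Measure (Euc n)} (ha : AEStronglyMeasurable a μ) {Z : Euc n → Euc n}
    (hZ : AEStronglyMeasurable Z μ) :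
    AEStronglyMeasurable (fun x => modDensity g q (a x) ‖Z x‖) μ :=
  (hg.continuous_modPhi.comp_aestronglyMeasurable hZ.norm).add
    (ha.mul ((Real.continuous_rpow_const hq).comp_aestronglyMeasurable hZ.norm))

theorem IsGrowthFunction.integrable_modDensity_add (hg : IsGrowthFunction g) (hq : 0 ≤ q)
    {μ : Measure (Euc n)} (ha : AEStronglyMeasurable a μ) (ha0 : ∀ᵐ x ∂μ, 0 ≤ a x)
    {Y Z : Euc n → Euc n} (hY : AEStronglyMeasurable Y μ) (hZ : AEStronglyMeasurable Z μ)
    (hYi : Integrable (fun x => modDensity g q (a x) ‖Y x‖) μ)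
    (hZi : Integrable (fun x => modDensity g q (a x) ‖Z x‖) μ) :
    Integrable (fun x => modDensity g q (a x) ‖Y x + Z x‖) μ := by
  refine ((hYi.add hZi).const_mul (modConst g q)).mono'
    (hg.aestronglyMeasurable_modDensity hq ha (hY.add hZ)) ?_
  filter_upwards [ha0] with x hx
  rw [Real.norm_of_nonneg (modDensity_nonneg hx (norm_nonneg _))]
  exact hg.modDensity_norm_add_le hq hx _ _

theorem IsGrowthFunction.integrable_modDensity_sub (hg : IsGrowthFunction g) (hq : 0 ≤ q)
    {μ : Measure (Euc n)} (ha : AEStronglyMeasurable a μ) (ha0 : ∀ᵐ x ∂μ, 0 ≤ a x)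
    {Y Z : Euc n → Euc n} (hY : AEStronglyMeasurable Y μ) (hZ : AEStronglyMeasurable Z μ)
    (hYi : Integrable (fun x => modDensity g q (a x) ‖Y x‖) μ)
    (hZi : Integrable (fun x => modDensity g q (a x) ‖Z x‖) μ) :
    Integrable (fun x => modDensity g q (a x) ‖Y x - Z x‖) μ := by
  simpa only [sub_eq_add_neg, Pi.neg_apply] using
    hg.integrable_modDensity_add hq ha ha0 hY hZ.neg hYi (by simpa using hZi)

theorem IsGrowthFunction.convexOn_modDensity_norm (hg : IsGrowthFunction g) (hq : 1 ≤ q) {c : ℝ}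
    (hc : 0 ≤ c) : ConvexOn ℝ univ fun z : Euc n => modDensity g q c ‖z‖ := by
  refine ⟨convex_univ, fun x _ y _ s t hs ht hst => ?_⟩
  have h1 : ‖s • x + t • y‖ ≤ s * ‖x‖ + t * ‖y‖ := by
    refine (norm_add_le _ _).trans (le_of_eq ?_)
    rw [norm_smul, norm_smul, Real.norm_of_nonneg hs, Real.norm_of_nonneg ht]
  exact (hg.modDensity_mono (by linarith) hc (norm_nonneg _) h1).trans
    ((hg.convexOn_modDensity hq hc).2 (mem_Ici.2 (norm_nonneg x)) (mem_Ici.2 (norm_nonneg y))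
      hs ht hst)

/-- The modular density of a mollified bounded Sobolev function is controlled by the mollified
modular density. -/
theorem IsGrowthFunction.exists_modDensity_mollify_le (hg : IsGrowthFunction g) (hq : 1 < q)
    {α A : ℝ} (hα : 0 < α) (hqα : q ≤ 1 + α) (hA : 0 ≤ A) {V : Set (Euc n)}
    (hVm : MeasurableSet V) (ha0 : ∀ x ∈ V, 0 ≤ a x)
    (haA : ∀ x ∈ V, ∀ y ∈ V, |a x - a y| ≤ A * ‖x - y‖ ^ α) {f : Euc n → ℝ} {F : Euc n → Euc n}
    (hfF : IsWeakGrad V f F) (hf : IntegrableOn f V) (hF : IntegrableOn F V) {M : ℝ}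
    (hM : ∀ x, |f x| ≤ M) (hN : IntegrableOn (fun y => modDensity g q (a y) ‖F y‖) V) :
    ∃ Q : ℝ, 0 ≤ Q ∧ ∀ (j : ℕ) (x : Euc n), Metric.closedBall x (1 / ((j : ℝ) + 1)) ⊆ V →
      modDensity g q (a x) ‖mollify j (V.indicator F) x‖ ≤
        mollify j (V.indicator fun y => modDensity g q (a y) ‖F y‖ + Q * ‖F y‖) x := by
  obtain ⟨C, hC0, hC⟩ := exists_norm_gradient_mollify_le n
  have hM0 : 0 ≤ M := (abs_nonneg _).trans (hM 0)
  have hfi : Integrable (V.indicator f) := (integrable_indicator_iff hVm).2 hf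
  have hFi : Integrable (V.indicator F) := (integrable_indicator_iff hVm).2 hF
  set Q : ℝ := A * (C * M) ^ (q - 1) with hQ
  have hQ0 : 0 ≤ Q := by positivity
  refine ⟨Q, hQ0, fun j x hx => ?_⟩
  have hh : Integrable (V.indicator fun y => modDensity g q (a y) ‖F y‖ + Q * ‖F y‖) :=
    (integrable_indicator_iff hVm).2 (hN.add (hF.norm.const_mul Q))
  have hR : (0 : ℝ) < (j : ℝ) + 1 := by positivity
  have hR1 : (1 : ℝ) ≤ (j : ℝ) + 1 := by linarith [(Nat.cast_nonneg j : (0 : ℝ) ≤ j)]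
  set R : ℝ := (j : ℝ) + 1
  have hxV : x ∈ V := hx (Metric.mem_closedBall_self (by positivity))
  -- A lower bound for `a` on the whole ball of radius `1 / R` by Hölder continuity. It is cut at
  -- zero to keep the frozen density convex.
  set m : ℝ := max 0 (a x - A * (1 / R) ^ α) with hm
  have hm0 : 0 ≤ m := le_max_left _ _
  have hym : ∀ y, ‖x - y‖ < 1 / R → y ∈ V ∧ m ≤ a y := by
    intro y hy
    have hyV : y ∈ V := hx (by rw [Metric.mem_closedBall, dist_comm, dist_eq_norm]; exact hy.le)
    refine ⟨hyV, max_le (ha0 y hyV) ?_⟩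
    have h1 := (le_abs_self _).trans (haA x hxV y hyV)
    have h2 : A * ‖x - y‖ ^ α ≤ A * (1 / R) ^ α := by gcongr
    linarith
  set t : ℝ := ‖mollify j (V.indicator F) x‖ with ht
  have ht0 : 0 ≤ t := norm_nonneg _
  have htle : t ≤ C * M * R := by
    have h1 := hC j (V.indicator f) M hfi (fun y => by
      by_cases hy : y ∈ V <;> simp [hy, hM, hM0]) x
    rwa [hfF.gradient_mollify_indicator hVm hf hF j hx] at h1
  -- replacing the coefficient at `x` by its lower bound near `x` costs a linear term
  have hstep : modDensity g q (a x) t ≤ modDensity g q m t + Q * t := by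
    have h1 : a x ≤ m + A * (1 / R) ^ α := by linarith [le_max_right 0 (a x - A * (1 / R) ^ α)]
    have h2 : t ^ q ≤ (C * M * R) ^ (q - 1) * t := by
      rcases ht0.eq_or_lt with h0 | h0
      · rw [← h0, Real.zero_rpow (by linarith)]; simp
      · calc t ^ q = t ^ (q - 1) * t := by
              nth_rewrite 3 [← Real.rpow_one t]
              rw [← Real.rpow_add h0]; congr 1; ring
          _ ≤ _ := by gcongr
    -- The powers of `R` combine to `R ^ (q - 1 - α)`, at most one since `R ≥ 1` and `q ≤ 1 + α`.
    -- This is where the relation between the exponents enters.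
    have h3 : (1 / R) ^ α * (C * M * R) ^ (q - 1) ≤ (C * M) ^ (q - 1) := by
      rw [Real.mul_rpow (by positivity) hR.le, one_div, Real.inv_rpow hR.le,
        ← Real.rpow_neg hR.le]
      have : R ^ (-α) * R ^ (q - 1) ≤ 1 := by
        rw [← Real.rpow_add hR]
        exact Real.rpow_le_one_of_one_le_of_nonpos hR1 (by linarith)
      calc R ^ (-α) * ((C * M) ^ (q - 1) * R ^ (q - 1))
          = (C * M) ^ (q - 1) * (R ^ (-α) * R ^ (q - 1)) := by ring
        _ ≤ (C * M) ^ (q - 1) * 1 := by gcongr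
        _ = _ := mul_one _
    have h4 : A * (1 / R) ^ α * t ^ q ≤ Q * t := by
      calc A * (1 / R) ^ α * t ^ q ≤ A * (1 / R) ^ α * ((C * M * R) ^ (q - 1) * t) := by gcongr
        _ = A * ((1 / R) ^ α * (C * M * R) ^ (q - 1)) * t := by ring
        _ ≤ A * (C * M) ^ (q - 1) * t := by gcongr
    have h5 : a x * t ^ q ≤ (m + A * (1 / R) ^ α) * t ^ q := by gcongr
    unfold modDensity
    linarith
  set Ψ : Euc n → ℝ := fun z => modDensity g q m ‖z‖ + Q * ‖z‖ with hΨ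
  have hΨconv : ConvexOn ℝ univ Ψ :=
    (hg.convexOn_modDensity_norm hq.le hm0).add ((convexOn_norm convex_univ).smul hQ0)
  have hΨc : Continuous Ψ :=
    ((hg.continuous_modDensity (by linarith) m).comp continuous_norm).add
      (continuous_const.mul continuous_norm)
  have hΨ0 : ∀ z, 0 ≤ Ψ z := fun z =>
    add_nonneg (modDensity_nonneg hm0 (norm_nonneg z)) (by positivity)
  -- Inside the ball `m ≤ a y` restores the variable coefficient; outside it the mollifier vanishes.
  have hle : ∀ y, mollifier n j (x - y) • Ψ (V.indicator F y) ≤ mollifier n j (x - y) •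
      V.indicator (fun y => modDensity g q (a y) ‖F y‖ + Q * ‖F y‖) y := by
    intro y
    by_cases hy : ‖x - y‖ < 1 / R
    · obtain ⟨hyV, hmy⟩ := hym y hy
      simp only [smul_eq_mul, indicator_of_mem hyV, hΨ]
      refine mul_le_mul_of_nonneg_left ?_ (mollifier_nonneg j _)
      unfold modDensity
      gcongr
    · simp [mollifier_eq_zero j (not_lt.1 hy)]
  have hi : Integrable fun y => mollifier n j (x - y) • Ψ (V.indicator F y) := by
    refine (integrable_mollifier_smul j hh x).mono' ?_ (ae_of_all _ fun y => ?_)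
    · exact ((continuous_mollifier j).comp
        (continuous_const.sub continuous_id)).aestronglyMeasurable.smul
        (hΨc.comp_aestronglyMeasurable hFi.aestronglyMeasurable)
    · rw [Real.norm_of_nonneg (smul_nonneg (mollifier_nonneg j _) (hΨ0 _))]
      exact hle y
  exact hstep.trans ((hΨconv.map_mollify_le hΨc j hFi x hi).trans
    (integral_mono hi (integrable_mollifier_smul j hh x) hle))

theorem closedBall_subset_of_cthickening_subset {U V : Set (Euc n)} {δ r : ℝ} (h : Metric.cthickening δ U ⊆ V)
    (hr : r ≤ δ) {x : Euc n} (hx : x ∈ U) : Metric.closedBall x r ⊆ V :=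
  ((Metric.closedBall_subset_closedBall hr).trans
    (Metric.closedBall_subset_cthickening hx δ)).trans h

/-- The quasi-triangle inequality bounds the integrand by a multiple of `mollify j h` plus the
modular density of `F`, with `h` a fixed integrable function. These majorants converge in `L¹`,
while the integrand tends to zero almost everywhere. -/
theorem IsGrowthFunction.tendsto_integral_modDensity_mollify_sub (hg : IsGrowthFunction g)
    (hq : 1 < q) {α A : ℝ} (hα : 0 < α) (hqα : q ≤ 1 + α) (hA : 0 ≤ A) {U V : Set (Euc n)}
    (hVm : MeasurableSet V) (hUm : MeasurableSet U) {δ : ℝ} (hδ : 0 < δ)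
    (hUV : Metric.cthickening δ U ⊆ V) (ha0 : ∀ x ∈ V, 0 ≤ a x)
    (haA : ∀ x ∈ V, ∀ y ∈ V, |a x - a y| ≤ A * ‖x - y‖ ^ α) {f : Euc n → ℝ} {F : Euc n → Euc n}
    (hfF : IsWeakGrad V f F) (hf : IntegrableOn f V) (hF : IntegrableOn F V) {M : ℝ}
    (hM : ∀ x, |f x| ≤ M) (hN : IntegrableOn (fun y => modDensity g q (a y) ‖F y‖) V) :
    (∀ᶠ j in atTop, IntegrableOn
      (fun x => modDensity g q (a x) ‖mollify j (V.indicator F) x - F x‖) U) ∧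
    Tendsto (fun j => ∫ x in U, modDensity g q (a x) ‖mollify j (V.indicator F) x - F x‖) atTop
      (𝓝 0) := by
  obtain ⟨Q, hQ0, hQ⟩ := hg.exists_modDensity_mollify_le hq hα hqα hA hVm ha0 haA hfF hf hF hM hN
  have hFi : Integrable (V.indicator F) := (integrable_indicator_iff hVm).2 hF
  have hsub : U ⊆ V := (Metric.self_subset_cthickening U).trans hUV
  set h : Euc n → ℝ := V.indicator fun y => modDensity g q (a y) ‖F y‖ + Q * ‖F y‖ with hh_def
  have hh : Integrable h := (integrable_indicator_iff hVm).2 (hN.add (hF.norm.const_mul Q))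
  have hh0 : ∀ x, 0 ≤ h x := fun x => indicator_nonneg (fun y hy =>
    add_nonneg (modDensity_nonneg (ha0 y hy) (norm_nonneg _)) (by positivity)) x
  have hq0 : 0 ≤ q := by linarith
  have ham : AEStronglyMeasurable a (volume.restrict U) :=
    ((continuousOn_of_abs_sub_le_rpow hα haA).mono hsub).aestronglyMeasurable hUm
  have hFm : AEStronglyMeasurable F (volume.restrict U) := (hF.mono_set hsub).aestronglyMeasurable
  have hFjm : ∀ j, AEStronglyMeasurable (mollify j (V.indicator F)) (volume.restrict U) := fun j =>
    (integrable_mollify j hFi).aestronglyMeasurable.restrict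
  have hNm : ∀ j, AEStronglyMeasurable
      (fun x => modDensity g q (a x) ‖mollify j (V.indicator F) x - F x‖) (volume.restrict U) :=
    fun j => hg.aestronglyMeasurable_modDensity hq0 ham ((hFjm j).sub hFm)
  obtain ⟨j₀, hj₀⟩ : ∃ j₀ : ℕ, ∀ j ≥ j₀, 1 / ((j : ℝ) + 1) < δ := eventually_atTop.1
    (tendsto_one_div_add_atTop_nhds_zero_nat.eventually (gt_mem_nhds hδ))
  set K : ℝ := modConst g q
  have hb : ∀ j ≥ j₀, ∀ᵐ x ∂volume.restrict U,
      modDensity g q (a x) ‖mollify j (V.indicator F) x - F x‖ ≤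
        K * (mollify j h x + modDensity g q (a x) ‖F x‖) := by
    intro j hj
    refine (ae_restrict_iff' hUm).2 (ae_of_all _ fun x hx => ?_)
    refine (hg.modDensity_norm_sub_le hq0 (ha0 x (hsub hx)) _ _).trans ?_
    refine mul_le_mul_of_nonneg_left ?_ (modConst_pos g q).le
    gcongr
    exact hQ j x (closedBall_subset_of_cthickening_subset hUV (hj₀ j hj).le hx)
  have hn0 : ∀ j, ∀ᵐ x ∂volume.restrict U,
      0 ≤ modDensity g q (a x) ‖mollify j (V.indicator F) x - F x‖ := fun j =>
    (ae_restrict_iff' hUm).2 (ae_of_all _ fun x hx =>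
      modDensity_nonneg (ha0 x (hsub hx)) (norm_nonneg _))
  have hbi : ∀ j, IntegrableOn (fun x => K * (mollify j h x + modDensity g q (a x) ‖F x‖)) U :=
    fun j => ((integrable_mollify j hh).integrableOn.add (hN.mono_set hsub)).const_mul K
  refine ⟨?_, ?_⟩
  · filter_upwards [eventually_ge_atTop j₀] with j hj
    refine (hbi j).mono' (hNm j) ?_
    filter_upwards [hb j hj, hn0 j] with x h1 h2
    rwa [Real.norm_of_nonneg h2]
  -- The majorant is valid only once the radius is below `δ`, so the sequence is started at `j₀`.
  rw [← tendsto_add_atTop_iff_nat j₀]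
  refine tendsto_integral_zero_of_le_of_tendsto_L1
    (h := fun j x => K * (mollify (j + j₀) h x + modDensity g q (a x) ‖F x‖))
    (H := fun x => K * (h x + modDensity g q (a x) ‖F x‖)) (fun j => hNm _) (fun j => hn0 _)
    (fun j => hb _ (Nat.le_add_left _ _)) (fun j => hbi _)
    ((hh.integrableOn.add (hN.mono_set hsub)).const_mul K) ?_ ?_
  · have h1 := ae_restrict_of_ae (s := U) (ae_tendsto_mollify hFi)
    filter_upwards [h1, ae_restrict_mem hUm] with x hx hxU
    rw [indicator_of_mem (hsub hxU)] at hx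
    have h2 : Tendsto (fun j => ‖mollify j (V.indicator F) x - F x‖) atTop (𝓝 0) := by
      simpa using (hx.sub_const (F x)).norm
    have h3 := ((hg.continuous_modDensity hq0 (a x)).tendsto 0).comp h2
    rw [modDensity_zero (by linarith)] at h3
    exact h3.comp (tendsto_add_atTop_nat j₀)
  · have h1 := ((tendsto_integral_abs_mollify_sub hh (ae_of_all _ hh0)).const_mul K).comp
      (tendsto_add_atTop_nat j₀)
    rw [mul_zero] at h1
    refine squeeze_zero (fun j => integral_nonneg fun x => abs_nonneg _) (fun j => ?_) h1
    have h2 : Integrable fun x => |mollify (j + j₀) h x - h x| :=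
      ((integrable_mollify _ hh).sub hh).abs
    calc ∫ x in U, |K * (mollify (j + j₀) h x + modDensity g q (a x) ‖F x‖) -
          K * (h x + modDensity g q (a x) ‖F x‖)|
        = ∫ x in U, K * |mollify (j + j₀) h x - h x| := by
          congr 1; ext x
          rw [← mul_sub, add_sub_add_right_eq_sub, abs_mul, abs_of_pos (modConst_pos g q)]
      _ ≤ ∫ x, K * |mollify (j + j₀) h x - h x| :=
          setIntegral_le_integral (h2.const_mul K)
            (ae_of_all _ fun x => mul_nonneg (modConst_pos g q).le (abs_nonneg _))
      _ = _ := integral_const_mul _ _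

end Modular

/-! ### Smooth truncation -/

/-- A smooth truncation at height comparable to `k + 1`. -/
def smoothTrunc (k : ℕ) (t : ℝ) : ℝ := ((k : ℝ) + 1) * Real.arctan (t / ((k : ℝ) + 1))

section Trunc

variable (k : ℕ)

theorem contDiff_smoothTrunc : ContDiff ℝ ∞ (smoothTrunc k) :=
  contDiff_const.mul (Real.contDiff_arctan.comp (contDiff_id.div_const _))

@[simp] theorem smoothTrunc_zero : smoothTrunc k 0 = 0 := by simp [smoothTrunc]

theorem deriv_smoothTrunc (t : ℝ) :
    deriv (smoothTrunc k) t = 1 / (1 + (t / ((k : ℝ) + 1)) ^ 2) := by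
  have hk : ((k : ℝ) + 1) ≠ 0 := by positivity
  have h : HasDerivAt (smoothTrunc k)
      (((k : ℝ) + 1) * (1 / (1 + (t / ((k : ℝ) + 1)) ^ 2) * (1 / ((k : ℝ) + 1)))) t :=
    (((hasDerivAt_id t).div_const _).arctan).const_mul _
  rw [h.deriv]
  field_simp

theorem deriv_smoothTrunc_pos (t : ℝ) : 0 < deriv (smoothTrunc k) t := by
  rw [deriv_smoothTrunc]; positivity

theorem deriv_smoothTrunc_le_one (t : ℝ) : deriv (smoothTrunc k) t ≤ 1 := by
  rw [deriv_smoothTrunc, div_le_one (by positivity)]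
  linarith [sq_nonneg (t / ((k : ℝ) + 1))]

theorem abs_deriv_smoothTrunc_le (t : ℝ) : |deriv (smoothTrunc k) t| ≤ 1 := by
  rw [abs_of_pos (deriv_smoothTrunc_pos k t)]
  exact deriv_smoothTrunc_le_one k t

theorem abs_smoothTrunc_le_self (t : ℝ) : |smoothTrunc k t| ≤ |t| := by
  have := Convex.norm_image_sub_le_of_norm_deriv_le (f := smoothTrunc k) (C := 1) (s := univ)
    (x := 0) (y := t) (fun x _ => (contDiff_smoothTrunc k).differentiable (by simp) x)
    (fun x _ => abs_deriv_smoothTrunc_le k x) convex_univ (mem_univ _) (mem_univ _)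
  simpa using this

theorem smoothTrunc_nonneg {t : ℝ} (ht : 0 ≤ t) : 0 ≤ smoothTrunc k t :=
  mul_nonneg (by positivity) (Real.arctan_nonneg.2 (by positivity))

theorem abs_smoothTrunc_le (t : ℝ) : |smoothTrunc k t| ≤ ((k : ℝ) + 1) * (Real.pi / 2) := by
  rw [smoothTrunc, abs_mul, abs_of_pos (by positivity : (0 : ℝ) < (k : ℝ) + 1)]
  gcongr
  exact abs_le.2 ⟨(Real.neg_pi_div_two_lt_arctan _).le, (Real.arctan_lt_pi_div_two _).le⟩

/-- The truncations are the difference quotients of `s ↦ arctan (s * t)` at zero with step `1 / (k +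
1)`. -/
theorem tendsto_smoothTrunc (t : ℝ) : Tendsto (fun k => smoothTrunc k t) atTop (𝓝 t) := by
  have h : HasDerivAt (fun s : ℝ => Real.arctan (s * t)) t 0 := by
    simpa using ((hasDerivAt_id (0 : ℝ)).mul_const t).arctan
  rw [hasDerivAt_iff_tendsto_slope_zero] at h
  have h1 : Tendsto (fun k : ℕ => 1 / ((k : ℝ) + 1)) atTop (𝓝[≠] 0) :=
    tendsto_nhdsWithin_iff.2 ⟨tendsto_one_div_add_atTop_nhds_zero_nat,
      Eventually.of_forall fun k => by
        have : 1 / ((k : ℝ) + 1) ≠ 0 := by positivity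
        exact this⟩
  refine (h.comp h1).congr fun k => ?_
  simp [smoothTrunc, div_eq_inv_mul]

theorem tendsto_deriv_smoothTrunc (t : ℝ) :
    Tendsto (fun k => deriv (smoothTrunc k) t) atTop (𝓝 1) := by
  simp only [deriv_smoothTrunc]
  have h1 : Tendsto (fun k : ℕ => t / ((k : ℝ) + 1)) atTop (𝓝 0) := by
    simpa [div_eq_mul_inv] using
      (tendsto_one_div_add_atTop_nhds_zero_nat (𝕜 := ℝ)).const_mul t
  have h2 := ((h1.pow 2).const_add 1).inv₀ (by norm_num)
  simpa using h2

end Trunc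

end

noncomputable section

/-! ### Smooth approximation in the modular -/

section Approx

variable {n : ℕ} {g : ℝ → ℝ} {a : Euc n → ℝ} {q : ℝ}

/-- The gradient error is `(T' - 1) D` with `T'` in `(0, 1]`, so its modular density is dominated by
that of `D` itself. -/
theorem IsGrowthFunction.tendsto_integral_modDensity_trunc (hg : IsGrowthFunction g) (hq : 1 < q)
    {V : Set (Euc n)} (hVm : MeasurableSet V) (ha0 : ∀ x ∈ V, 0 ≤ a x)
    (ham : AEStronglyMeasurable a (volume.restrict V)) {u : Euc n → ℝ} {D : Euc n → Euc n}
    (hu : IntegrableOn u V) (hD : IntegrableOn D V)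
    (hN : IntegrableOn (fun y => modDensity g q (a y) ‖D y‖) V) :
    (∀ k, IntegrableOn
      (fun x => modDensity g q (a x) ‖deriv (smoothTrunc k) (u x) • D x - D x‖) V) ∧
    Tendsto (fun k => ∫ x in V, modDensity g q (a x) ‖deriv (smoothTrunc k) (u x) • D x - D x‖)
      atTop (𝓝 0) := by
  have hm : ∀ k, AEStronglyMeasurable
      (fun x => modDensity g q (a x) ‖deriv (smoothTrunc k) (u x) • D x - D x‖)
      (volume.restrict V) := fun k =>
    hg.aestronglyMeasurable_modDensity (by linarith) ham
      (((((contDiff_smoothTrunc k).continuous_deriv (by simp)).comp_aestronglyMeasurable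
        hu.aestronglyMeasurable).smul hD.aestronglyMeasurable).sub hD.aestronglyMeasurable)
  have hb : ∀ k, ∀ᵐ x ∂volume.restrict V,
      ‖modDensity g q (a x) ‖deriv (smoothTrunc k) (u x) • D x - D x‖‖ ≤
        modDensity g q (a x) ‖D x‖ := fun k => by
    refine (ae_restrict_iff' hVm).2 (ae_of_all _ fun x hx => ?_)
    rw [Real.norm_of_nonneg (modDensity_nonneg (ha0 x hx) (norm_nonneg _))]
    refine hg.modDensity_mono (by linarith) (ha0 x hx) (norm_nonneg _) ?_
    have e : deriv (smoothTrunc k) (u x) • D x - D x =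
        (deriv (smoothTrunc k) (u x) - 1) • D x := by rw [sub_smul, one_smul]
    rw [e, norm_smul]
    refine mul_le_of_le_one_left (norm_nonneg _) (abs_le.2 ⟨?_, ?_⟩)
    · linarith [deriv_smoothTrunc_pos k (u x)]
    · linarith [deriv_smoothTrunc_le_one k (u x)]
  refine ⟨fun k => hN.mono' (hm k) (hb k), ?_⟩
  have h := tendsto_integral_of_dominated_convergence (f := fun _ => (0 : ℝ))
    (μ := volume.restrict V) _ hm hN hb (ae_of_all _ fun x => ?_)
  · simpa using h
  · have h1 : Tendsto (fun k => ‖deriv (smoothTrunc k) (u x) • D x - D x‖) atTop (𝓝 0) := by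
      simpa using (((tendsto_deriv_smoothTrunc (u x)).smul_const (D x)).sub_const (D x)).norm
    have h2 := ((hg.continuous_modDensity (by linarith : 0 ≤ q) (a x)).tendsto 0).comp h1
    rw [modDensity_zero (by linarith)] at h2
    exact h2

theorem tendsto_integral_abs_smoothTrunc_sub {X : Type*} [MeasurableSpace X] {μ : Measure X}
    {u : X → ℝ} (hu : Integrable u μ) :
    Tendsto (fun k => ∫ x, |smoothTrunc k (u x) - u x| ∂μ) atTop (𝓝 0) := by
  have h := tendsto_integral_of_dominated_convergence (f := fun _ => (0 : ℝ)) (μ := μ)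
    (F := fun k x => |smoothTrunc k (u x) - u x|) (fun x => 2 * ‖u x‖)
    (fun k => (((contDiff_smoothTrunc k).continuous.comp_aestronglyMeasurable
      hu.aestronglyMeasurable).sub hu.aestronglyMeasurable).norm) (hu.norm.const_mul 2)
    (fun k => ae_of_all _ fun x => ?_) (ae_of_all _ fun x => ?_)
  · simpa using h
  · rw [Real.norm_of_nonneg (abs_nonneg _), Real.norm_eq_abs]
    exact (abs_sub _ _).trans (by linarith [abs_smoothTrunc_le_self k (u x)])
  · simpa using ((tendsto_smoothTrunc (u x)).sub_const (u x)).abs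

/-- A nonnegative Sobolev function of finite modular is approximated in the modular by nonnegative
test functions that do not exceed its local bounds. -/
theorem IsGrowthFunction.exists_smooth_approx (hg : IsGrowthFunction g) (hq : 1 < q) {α A : ℝ}
    (hα : 0 < α) (hqα : q ≤ 1 + α) (hA : 0 ≤ A) {U V : Set (Euc n)} (hV : IsOpen V)
    (hVb : Bornology.IsBounded V) (hUm : MeasurableSet U) {δ : ℝ} (hδ : 0 < δ)
    (hUV : Metric.cthickening δ U ⊆ V) (ha0 : ∀ x ∈ V, 0 ≤ a x)
    (haA : ∀ x ∈ V, ∀ y ∈ V, |a x - a y| ≤ A * ‖x - y‖ ^ α) {u : Euc n → ℝ} {D : Euc n → Euc n}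
    (huD : IsWeakGrad V u D) (hu : IntegrableOn u V) (hD : IntegrableOn D V)
    (hN : IntegrableOn (fun y => modDensity g q (a y) ‖D y‖) V)
    (hu0 : ∀ᵐ x ∂volume.restrict V, 0 ≤ u x) {r ε : ℝ} (hr : 0 < r) (hε : 0 < ε) :
    ∃ η : Euc n → ℝ, ContDiff ℝ ∞ η ∧ HasCompactSupport η ∧ (∀ x, 0 ≤ η x) ∧
      (∀ M : ℝ, (∀ᵐ y ∂volume.restrict (Metric.thickening r U), |u y| ≤ M) → ∀ x ∈ U, η x ≤ M) ∧
      (∫ x in U, |η x - u x| < ε) ∧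
      IntegrableOn (fun x => modDensity g q (a x) ‖gradient η x - D x‖) U ∧
      ∫ x in U, modDensity g q (a x) ‖gradient η x - D x‖ < ε := by
  have hVm := hV.measurableSet
  have hq0 : 0 ≤ q := by linarith
  have hsub : U ⊆ V := (Metric.self_subset_cthickening U).trans hUV
  have hac := continuousOn_of_abs_sub_le_rpow hα haA
  have haV : AEStronglyMeasurable a (volume.restrict V) := hac.aestronglyMeasurable hVm
  have haU : AEStronglyMeasurable a (volume.restrict U) :=
    (hac.mono hsub).aestronglyMeasurable hUm
  have haU0 : ∀ᵐ x ∂volume.restrict U, 0 ≤ a x :=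
    (ae_restrict_iff' hUm).2 (ae_of_all _ fun x hx => ha0 x (hsub hx))
  set K : ℝ := modConst g q
  have hK : 0 < K := modConst_pos g q
  -- truncation
  obtain ⟨hti, htl⟩ := hg.tendsto_integral_modDensity_trunc hq hVm ha0 haV hu hD hN
  -- Truncation and mollification errors are combined by a quasi-triangle inequality with constant
  -- `K`, hence the tolerance `ε / (2 * K)` for each.
  have hev1 : ∀ᶠ k in atTop, ∫ x in V, modDensity g q (a x)
      ‖deriv (smoothTrunc k) (u x) • D x - D x‖ < ε / (2 * K) :=
    htl.eventually (gt_mem_nhds (by positivity))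
  have hev2 : ∀ᶠ k in atTop, ∫ x in V, |smoothTrunc k (u x) - u x| < ε / 2 :=
    (tendsto_integral_abs_smoothTrunc_sub hu).eventually (gt_mem_nhds (by positivity))
  obtain ⟨k, hk1, hk2⟩ := (hev1.and hev2).exists
  set f : Euc n → ℝ := fun x => smoothTrunc k (u x) with hf_def
  set F : Euc n → Euc n := fun x => deriv (smoothTrunc k) (u x) • D x with hF_def
  have hfF : IsWeakGrad V f F := huD.comp_contDiff hV hu hD (contDiff_smoothTrunc k)
    (smoothTrunc_zero k) (abs_deriv_smoothTrunc_le k)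
  have hf : IntegrableOn f V :=
    hu.norm.mono' ((contDiff_smoothTrunc k).continuous.comp_aestronglyMeasurable
      hu.aestronglyMeasurable) (ae_of_all _ fun x => abs_smoothTrunc_le_self k _)
  have hF : IntegrableOn F V :=
    hD.bdd_smul 1 (((contDiff_smoothTrunc k).continuous_deriv (by simp)).comp_aestronglyMeasurable
      hu.aestronglyMeasurable) (ae_of_all _ fun x => abs_deriv_smoothTrunc_le k _)
  have hNF : IntegrableOn (fun y => modDensity g q (a y) ‖F y‖) V := by
    refine hN.mono' (hg.aestronglyMeasurable_modDensity hq0 haV hF.aestronglyMeasurable)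
      ((ae_restrict_iff' hVm).2 (ae_of_all _ fun x hx => ?_))
    rw [Real.norm_of_nonneg (modDensity_nonneg (ha0 x hx) (norm_nonneg _))]
    refine hg.modDensity_mono hq0 (ha0 x hx) (norm_nonneg _) ?_
    rw [hF_def, norm_smul]
    exact mul_le_of_le_one_left (norm_nonneg _) (abs_deriv_smoothTrunc_le k _)
  -- mollification
  have hfi : Integrable (V.indicator f) := (integrable_indicator_iff hVm).2 hf
  obtain ⟨hmi, hml⟩ := hg.tendsto_integral_modDensity_mollify_sub hq hα hqα hA hVm hUm hδ hUV ha0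
    haA hfF hf hF (fun x => abs_smoothTrunc_le k (u x)) hNF
  have hev3 : ∀ᶠ j in atTop, ∫ x in U, modDensity g q (a x)
      ‖mollify j (V.indicator F) x - F x‖ < ε / (2 * K) :=
    hml.eventually (gt_mem_nhds (by positivity))
  have hev4 : ∀ᶠ j in atTop, ∫ x, ‖mollify j (V.indicator f) x - V.indicator f x‖ < ε / 2 :=
    (tendsto_integral_norm_mollify_sub hfi).eventually (gt_mem_nhds (by positivity))
  -- Radius below `δ` keeps the averaging balls inside `V`; radius below `r` keeps them inside the
  -- neighbourhood in which the sup bound is measured.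
  have hev5 : ∀ᶠ j : ℕ in atTop, 1 / ((j : ℝ) + 1) < min δ r :=
    tendsto_one_div_add_atTop_nhds_zero_nat.eventually (gt_mem_nhds (lt_min hδ hr))
  obtain ⟨j, hji, hj3, hj4, hj5⟩ := (hmi.and (hev3.and (hev4.and hev5))).exists
  have hf0 : ∀ᵐ y ∂(volume : Measure (Euc n)), 0 ≤ V.indicator f y := by
    filter_upwards [(ae_restrict_iff' hVm).1 hu0] with y hy
    exact indicator_apply_nonneg fun hyV => smoothTrunc_nonneg k (hy hyV)
  have hgrad : ∀ x ∈ U, gradient (mollify j (V.indicator f)) x = mollify j (V.indicator F) x :=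
    fun x hx => hfF.gradient_mollify_indicator hVm hf hF j
      (closedBall_subset_of_cthickening_subset hUV (hj5.le.trans (min_le_left _ _)) hx)
  have hsupp : HasCompactSupport (V.indicator f) := by
    refine HasCompactSupport.of_support_subset_isCompact hVb.isCompact_closure ?_
    exact (support_indicator_subset).trans subset_closure
  have hsplit : ∀ x, gradient (mollify j (V.indicator f)) x - D x =
      (gradient (mollify j (V.indicator f)) x - F x) + (F x - D x) := fun x => by abel
  have hGi : IntegrableOn (fun x => modDensity g q (a x)
      ‖gradient (mollify j (V.indicator f)) x - F x‖) U :=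
    hji.congr_fun (fun x hx => by simp only [hgrad x hx]) hUm
  have hGI : ∫ x in U, modDensity g q (a x) ‖gradient (mollify j (V.indicator f)) x - F x‖ <
      ε / (2 * K) := by
    refine lt_of_eq_of_lt (setIntegral_congr_fun hUm fun x hx => ?_) hj3
    simp only [hgrad x hx]
  have hTi : IntegrableOn (fun x => modDensity g q (a x) ‖F x - D x‖) U :=
    (hti k).mono_set hsub
  have hTI : ∫ x in U, modDensity g q (a x) ‖F x - D x‖ < ε / (2 * K) := by
    refine (setIntegral_mono_set (hti k) ?_ (LE.le.eventuallyLE hsub)).trans_lt hk1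
    exact (ae_restrict_iff' hVm).2 (ae_of_all _ fun x hx =>
      modDensity_nonneg (ha0 x hx) (norm_nonneg _))
  have hgm : AEStronglyMeasurable (gradient (mollify j (V.indicator f))) (volume.restrict U) :=
    (contDiff_mollify j hfi).continuous_gradient.aestronglyMeasurable
  have hFm : AEStronglyMeasurable F (volume.restrict U) := (hF.mono_set hsub).aestronglyMeasurable
  have hDm : AEStronglyMeasurable D (volume.restrict U) := (hD.mono_set hsub).aestronglyMeasurable
  have hfin : IntegrableOn (fun x => modDensity g q (a x)
      ‖gradient (mollify j (V.indicator f)) x - D x‖) U := by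
    simp only [hsplit]
    exact hg.integrable_modDensity_add hq0 haU haU0 (hgm.sub hFm) (hFm.sub hDm) hGi hTi
  refine ⟨mollify j (V.indicator f), contDiff_mollify j hfi, hasCompactSupport_mollify j hsupp,
    fun x => mollify_nonneg j x hf0, ?_, ?_, hfin, ?_⟩
  · intro M hM x hx
    refine mollify_le_of_ae_le j hfi x ?_
    filter_upwards [(ae_restrict_iff' Metric.isOpen_thickening.measurableSet).1 hM] with y hy hxy
    have hyV : y ∈ V := closedBall_subset_of_cthickening_subset hUV (hj5.le.trans (min_le_left _ _)) hx
      (by rw [Metric.mem_closedBall, dist_comm, dist_eq_norm]; exact hxy.le)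
    have hyr : y ∈ Metric.thickening r U := by
      refine Metric.mem_thickening_iff.2 ⟨x, hx, ?_⟩
      rw [dist_comm, dist_eq_norm]
      exact hxy.trans (hj5.trans_le (min_le_right _ _))
    rw [indicator_of_mem hyV]
    exact (le_abs_self _).trans ((abs_smoothTrunc_le_self k (u y)).trans (hy hyr))
  · have h1 : IntegrableOn (fun x => |mollify j (V.indicator f) x - V.indicator f x|) U :=
      ((integrable_mollify j hfi).sub hfi).norm.integrableOn
    have h2 : IntegrableOn (fun x => |f x - u x|) V := (hf.sub hu).norm
    have h3 : IntegrableOn (fun x => |mollify j (V.indicator f) x - u x|) U :=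
      ((integrable_mollify j hfi).integrableOn.sub (hu.mono_set hsub)).norm
    have h4 : ∫ x in U, |mollify j (V.indicator f) x - V.indicator f x| < ε / 2 :=
      (setIntegral_le_integral ((integrable_mollify j hfi).sub hfi).norm
        (ae_of_all _ fun x => norm_nonneg _)).trans_lt hj4
    have h5 : ∫ x in U, |f x - u x| < ε / 2 :=
      (setIntegral_mono_set h2 (ae_of_all _ fun x => abs_nonneg _)
        (LE.le.eventuallyLE hsub)).trans_lt hk2
    have h6 : ∫ x in U, |mollify j (V.indicator f) x - u x| ≤
        ∫ x in U, (|mollify j (V.indicator f) x - V.indicator f x| + |f x - u x|) := by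
      refine setIntegral_mono_on h3 (h1.add (h2.mono_set hsub)) hUm fun x hx => ?_
      rw [indicator_of_mem (hsub hx)]
      exact abs_sub_le _ _ _
    rw [integral_add h1 (h2.mono_set hsub)] at h6
    linarith
  · have h6 : ∫ x in U, modDensity g q (a x) ‖gradient (mollify j (V.indicator f)) x - D x‖ ≤
        ∫ x in U, K * (modDensity g q (a x) ‖gradient (mollify j (V.indicator f)) x - F x‖ +
          modDensity g q (a x) ‖F x - D x‖) := by
      refine setIntegral_mono_on hfin ((hGi.add hTi).const_mul K) hUm fun x hx => ?_
      rw [hsplit]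
      exact hg.modDensity_norm_add_le hq0 (ha0 x (hsub hx)) _ _
    rw [integral_const_mul, integral_add hGi hTi] at h6
    refine h6.trans_lt ?_
    calc _ < K * (ε / (2 * K) + ε / (2 * K)) := by gcongr
      _ = ε := by field_simp; ring

end Approx

end

noncomputable section

/-! ### Convergence of the energy -/

section Energy

variable {n : ℕ} {g : ℝ → ℝ} {L : Euc n → ℝ} {Λ : ℝ} {a : Euc n → ℝ} {q s : ℝ}
  {μ : Measure (Euc n)}

theorem continuous_integrandH (hL : Continuous L) (hq : 0 ≤ q) (x : Euc n) :
    Continuous (integrandH L a s q x) :=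
  hL.add (continuous_const.mul ((Real.continuous_rpow_const (by positivity)).comp
    (continuous_const.add (continuous_norm.pow 2))))

theorem aestronglyMeasurable_integrandH (hL : Continuous L) (hq : 0 ≤ q)
    (ha : AEStronglyMeasurable a μ) {Z : Euc n → Euc n} (hZ : AEStronglyMeasurable Z μ) :
    AEStronglyMeasurable (fun x => integrandH L a s q x (Z x)) μ := by
  have h : Continuous fun z : Euc n => (s ^ 2 + ‖z‖ ^ 2) ^ (q / 2) :=
    (Real.continuous_rpow_const (by positivity)).comp
      (continuous_const.add (continuous_norm.pow 2))
  exact (hL.comp_aestronglyMeasurable hZ).add (ha.mul (h.comp_aestronglyMeasurable hZ))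

theorem IsGrowthFunction.integrable_modDensity_of_integrandH [IsFiniteMeasure μ]
    (hg : IsGrowthFunction g) (hΛ : 1 ≤ Λ)
    (hLg : ∀ z : Euc n, z ≠ 0 →
      1 / Λ * (‖z‖ * g ‖z‖) ≤ L z ∧ L z ≤ Λ * (‖z‖ * g ‖z‖) + Λ) (hq : 0 < q)
    (ha : AEStronglyMeasurable a μ) (ha0 : ∀ᵐ x ∂μ, 0 ≤ a x) {Z : Euc n → Euc n}
    (hZ : Integrable Z μ) (hH : Integrable (fun x => integrandH L a s q x (Z x)) μ) :
    Integrable (fun x => modDensity g q (a x) ‖Z x‖) μ := by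
  refine (((hH.const_mul Λ).add (hZ.norm.const_mul (|g 0| + 1))).add
    (integrable_const (Λ * |L 0|))).mono'
    (hg.aestronglyMeasurable_modDensity hq.le ha hZ.aestronglyMeasurable) ?_
  filter_upwards [ha0] with x hx
  rw [Real.norm_of_nonneg (modDensity_nonneg hx (norm_nonneg _))]
  exact hg.modDensity_le_integrandH hΛ hLg hq hx (Z x)

theorem IsGrowthFunction.integrable_integrandH [IsFiniteMeasure μ] (hg : IsGrowthFunction g)
    (hL : Continuous L) (hΛ : 1 ≤ Λ)
    (hLg : ∀ z : Euc n, z ≠ 0 →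
      1 / Λ * (‖z‖ * g ‖z‖) ≤ L z ∧ L z ≤ Λ * (‖z‖ * g ‖z‖) + Λ) (hq : 0 < q)
    (ha : Integrable a μ) (ha0 : ∀ᵐ x ∂μ, 0 ≤ a x) {Z : Euc n → Euc n}
    (hZ : AEStronglyMeasurable Z μ) (hN : Integrable (fun x => modDensity g q (a x) ‖Z x‖) μ) :
    Integrable (fun x => integrandH L a s q x (Z x)) μ := by
  obtain ⟨C, -, hC⟩ := hg.exists_abs_integrandH_le (s := s) hΛ hLg hq a
  refine (((hN.add (integrable_const 1)).add ha).const_mul C).mono'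
    (aestronglyMeasurable_integrandH hL hq.le ha.aestronglyMeasurable hZ) ?_
  filter_upwards [ha0] with x hx
  exact hC x hx (Z x)

/-- The modular dominates the `L¹` norm, so there is convergence in measure and a subsequence
converging almost everywhere. -/
theorem exists_subseq_ae_tendsto_of_modDensity (ha0 : ∀ᵐ x ∂μ, 0 ≤ a x) {Z : ℕ → Euc n → Euc n}
    {W : Euc n → Euc n} (hZ : ∀ j, AEStronglyMeasurable (Z j) μ) (hW : AEStronglyMeasurable W μ)
    (hN : ∀ j, Integrable (fun x => modDensity g q (a x) ‖Z j x - W x‖) μ)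
    (hlim : Tendsto (fun j => ∫ x, modDensity g q (a x) ‖Z j x - W x‖ ∂μ) atTop (𝓝 0)) :
    ∃ ns : ℕ → ℕ, StrictMono ns ∧
      ∀ᵐ x ∂μ, Tendsto (fun j => Z (ns j) x) atTop (𝓝 (W x)) := by
  have hle : ∀ j, ∀ᵐ x ∂μ, ‖Z j x - W x‖ ≤ modDensity g q (a x) ‖Z j x - W x‖ := fun j => by
    filter_upwards [ha0] with x hx
    exact le_modDensity hx (norm_nonneg _)
  have hi : ∀ j, Integrable (fun x => Z j x - W x) μ := fun j =>
    (hN j).mono' ((hZ j).sub hW) (hle j)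
  have h1 : Tendsto (fun j => ∫ x, ‖Z j x - W x‖ ∂μ) atTop (𝓝 0) :=
    squeeze_zero (fun j => integral_nonneg fun x => norm_nonneg _)
      (fun j => integral_mono_ae (hi j).norm (hN j) (hle j)) hlim
  have h2 : Tendsto (fun j => eLpNorm (Z j - W) 1 μ) atTop (𝓝 0) := by
    have h3 := (ENNReal.continuous_ofReal.tendsto 0).comp h1
    rw [ENNReal.ofReal_zero] at h3
    refine h3.congr fun j => ?_
    rw [eLpNorm_one_eq_lintegral_enorm, Function.comp_apply,
      ofReal_integral_norm_eq_lintegral_enorm (hi j)]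
    rfl
  exact (tendstoInMeasure_of_tendsto_eLpNorm one_ne_zero hZ hW h2).exists_seq_tendsto_ae

/-- Growth and the quasi-triangle inequality bound the difference of the integrands by a fixed
integrable `B` plus a multiple of the modular density of `Z j - W`, which converges to `B` in `L¹`.
Pointwise convergence needs only continuity of the integrand in `z`. -/
theorem IsGrowthFunction.tendsto_integral_integrandH_of_ae [IsFiniteMeasure μ]
    (hg : IsGrowthFunction g) (hL : Continuous L) (hΛ : 1 ≤ Λ)
    (hLg : ∀ z : Euc n, z ≠ 0 →
      1 / Λ * (‖z‖ * g ‖z‖) ≤ L z ∧ L z ≤ Λ * (‖z‖ * g ‖z‖) + Λ) (hq : 0 < q)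
    (ha : Integrable a μ) (ha0 : ∀ᵐ x ∂μ, 0 ≤ a x) {Z : ℕ → Euc n → Euc n} {W : Euc n → Euc n}
    (hZ : ∀ j, AEStronglyMeasurable (Z j) μ) (hW : AEStronglyMeasurable W μ)
    (hNW : Integrable (fun x => modDensity g q (a x) ‖W x‖) μ)
    (hN : ∀ j, Integrable (fun x => modDensity g q (a x) ‖Z j x - W x‖) μ)
    (hlim : Tendsto (fun j => ∫ x, modDensity g q (a x) ‖Z j x - W x‖ ∂μ) atTop (𝓝 0))
    (hae : ∀ᵐ x ∂μ, Tendsto (fun j => Z j x) atTop (𝓝 (W x))) :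
    Tendsto (fun j => ∫ x, integrandH L a s q x (Z j x) ∂μ) atTop
      (𝓝 (∫ x, integrandH L a s q x (W x) ∂μ)) := by
  obtain ⟨C, hC0, hC⟩ := hg.exists_abs_integrandH_le (s := s) hΛ hLg hq a
  set K : ℝ := modConst g q
  have hK : 0 < K := modConst_pos g q
  have hZN : ∀ j, Integrable (fun x => modDensity g q (a x) ‖Z j x‖) μ := fun j => by
    simpa using hg.integrable_modDensity_add hq.le ha.aestronglyMeasurable ha0 ((hZ j).sub hW) hW
      (hN j) hNW
  have hHZ : ∀ j, Integrable (fun x => integrandH L a s q x (Z j x)) μ := fun j =>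
    hg.integrable_integrandH hL hΛ hLg hq ha ha0 (hZ j) (hZN j)
  have hHW : Integrable (fun x => integrandH L a s q x (W x)) μ :=
    hg.integrable_integrandH hL hΛ hLg hq ha ha0 hW hNW
  have hdi : ∀ j, Integrable
      (fun x => |integrandH L a s q x (Z j x) - integrandH L a s q x (W x)|) μ := fun j =>
    ((hHZ j).sub hHW).norm
  refine tendsto_integral_of_norm_sub_le hHZ hHW hdi (fun j x => le_rfl) ?_
  set B : Euc n → ℝ := fun x =>
    C * (K * modDensity g q (a x) ‖W x‖ + modDensity g q (a x) ‖W x‖ + 2 + 2 * a x) with hB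
  have hBi : Integrable B μ :=
    ((((hNW.const_mul K).add hNW).add (integrable_const 2)).add (ha.const_mul 2)).const_mul C
  have hsi : ∀ j, Integrable (fun x => B x + C * K * modDensity g q (a x) ‖Z j x - W x‖) μ :=
    fun j => hBi.add ((hN j).const_mul (C * K))
  refine tendsto_integral_zero_of_le_of_tendsto_L1
    (h := fun j x => B x + C * K * modDensity g q (a x) ‖Z j x - W x‖) (H := B)
    (fun j => (hdi j).aestronglyMeasurable) (fun j => ae_of_all _ fun x => abs_nonneg _)
    (fun j => ?_) hsi hBi ?_ ?_
  · filter_upwards [ha0] with x hx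
    have h1 := hC x hx (Z j x)
    have h2 := hC x hx (W x)
    have h3 := hg.modDensity_norm_add_le hq.le hx (Z j x - W x) (W x)
    rw [sub_add_cancel] at h3
    have h4 := mul_le_mul_of_nonneg_left h3 hC0
    refine (abs_sub _ _).trans ((add_le_add h1 h2).trans ?_)
    simp only [hB]
    linarith
  · filter_upwards [hae] with x hx
    have h1 := ((continuous_integrandH (a := a) (s := s) hL hq.le x).tendsto (W x)).comp hx
    simpa using (h1.sub_const (integrandH L a s q x (W x))).abs
  · have h1 := hlim.const_mul (C * K)
    rw [mul_zero] at h1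
    refine h1.congr' (Eventually.of_forall fun j => ?_)
    rw [← integral_const_mul]
    refine integral_congr_ae ?_
    filter_upwards [ha0] with x hx
    have h2 := modDensity_nonneg (g := g) (q := q) hx (norm_nonneg (Z j x - W x))
    rw [add_sub_cancel_left, abs_of_nonneg (by positivity)]

/-- Convergence in the modular implies convergence of the energies. -/
theorem IsGrowthFunction.tendsto_integral_integrandH [IsFiniteMeasure μ]
    (hg : IsGrowthFunction g) (hL : Continuous L) (hΛ : 1 ≤ Λ)
    (hLg : ∀ z : Euc n, z ≠ 0 →
      1 / Λ * (‖z‖ * g ‖z‖) ≤ L z ∧ L z ≤ Λ * (‖z‖ * g ‖z‖) + Λ) (hq : 0 < q)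
    (ha : Integrable a μ) (ha0 : ∀ᵐ x ∂μ, 0 ≤ a x) {ι : Type*} {l : Filter ι}
    [l.IsCountablyGenerated] {Z : ι → Euc n → Euc n} {W : Euc n → Euc n}
    (hZ : ∀ j, AEStronglyMeasurable (Z j) μ) (hW : AEStronglyMeasurable W μ)
    (hNW : Integrable (fun x => modDensity g q (a x) ‖W x‖) μ)
    (hN : ∀ j, Integrable (fun x => modDensity g q (a x) ‖Z j x - W x‖) μ)
    (hlim : Tendsto (fun j => ∫ x, modDensity g q (a x) ‖Z j x - W x‖ ∂μ) l (𝓝 0)) :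
    Tendsto (fun j => ∫ x, integrandH L a s q x (Z j x) ∂μ) l
      (𝓝 (∫ x, integrandH L a s q x (W x) ∂μ)) := by
  -- Almost everywhere convergence is available along subsequences only. This suffices, since every
  -- sequence tending along `l` has a subsequence with the same limit of energies.
  refine tendsto_of_subseq_tendsto fun ns hns => ?_
  obtain ⟨ms, hms, hae⟩ := exists_subseq_ae_tendsto_of_modDensity ha0 (fun j => hZ (ns j)) hW
    (fun j => hN (ns j)) (hlim.comp hns)
  exact ⟨ms, hg.tendsto_integral_integrandH_of_ae hL hΛ hLg hq ha ha0 (fun j => hZ (ns (ms j))) hW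
    hNW (fun j => hN (ns (ms j))) ((hlim.comp hns).comp hms.tendsto_atTop) hae⟩

theorem IsGrowthFunction.integrable_integrandG (hg : IsGrowthFunction g) (hq : 0 ≤ q)
    (ha : AEStronglyMeasurable a μ) (ha0 : ∀ᵐ x ∂μ, 0 ≤ a x) {Z : Euc n → Euc n}
    (hZ : AEStronglyMeasurable Z μ) (hN : Integrable (fun x => modDensity g q (a x) ‖Z x‖) μ) :
    Integrable (fun x => integrandG g a q x ‖Z x‖) μ := by
  have h1 : Continuous fun z : Euc n => ‖z‖ * g ‖z‖ :=
    continuous_norm.mul (hg.cont.comp_continuous continuous_norm fun z =>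
      mem_Ici.2 (norm_nonneg z))
  refine (hN.const_mul (1 + |g 0|)).mono' ((h1.comp_aestronglyMeasurable hZ).add
    (ha.mul ((Real.continuous_rpow_const hq).comp_aestronglyMeasurable hZ.norm))) ?_
  filter_upwards [ha0] with x hx
  exact hg.abs_integrandG_le hx (norm_nonneg _)

end Energy

end

/-! ### Regular approximation above the obstacle -/

theorem CompactlyIn.exists_thickening {n : ℕ} {Ω Ω' : Set (Euc n)} (hΩ : IsOpen Ω)
    (hΩb : Bornology.IsBounded Ω) (hΩ' : CompactlyIn Ω' Ω) :
    ∃ (V : Set (Euc n)) (δ : ℝ), 0 < δ ∧ CompactlyIn V Ω ∧ Metric.cthickening δ Ω' ⊆ V := by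
  obtain ⟨δ, hδ, hδΩ⟩ := hΩ'.2.1.exists_cthickening_subset_open hΩ hΩ'.2.2
  have hcl : closure (Metric.thickening δ Ω') ⊆ Ω :=
    (Metric.closure_thickening_subset_cthickening δ Ω').trans
      ((Metric.cthickening_subset_of_subset δ subset_closure).trans hδΩ)
  refine ⟨Metric.thickening δ Ω', δ / 2, by positivity, ⟨Metric.isOpen_thickening, ?_, hcl⟩,
    Metric.cthickening_subset_thickening' hδ (half_lt_self hδ) Ω'⟩
  exact (hΩb.subset (subset_closure.trans hcl)).isCompact_closure

/-- With `b` the larger of the two norms, `|w - ψ| ≤ 2 b` on `U₀`, hence `η ≤ 2 b` and `|ψ + η| ≤ 3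
b` on `U`. If `b` is infinite the claim is empty. -/
theorem eLpNorm_add_top_le_of_bound {n : ℕ} {U U₀ : Set (Euc n)} (hU : MeasurableSet U)
    (hUU₀ : U ⊆ U₀) {w ψ η : Euc n → ℝ} (hη0 : ∀ x, 0 ≤ η x)
    (hη : ∀ M : ℝ, (∀ᵐ y ∂volume.restrict U₀, |(w - ψ) y| ≤ M) → ∀ x ∈ U, η x ≤ M) :
    eLpNorm (ψ + η) ∞ (volume.restrict U) ≤
      4 * max (eLpNorm w ∞ (volume.restrict U₀)) (eLpNorm ψ ∞ (volume.restrict U₀)) := by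
  set b := max (eLpNorm w ∞ (volume.restrict U₀)) (eLpNorm ψ ∞ (volume.restrict U₀)) with hb
  have hw : eLpNorm w ∞ (volume.restrict U₀) ≤ b := le_max_left _ _
  have hψ : eLpNorm ψ ∞ (volume.restrict U₀) ≤ b := le_max_right _ _
  rcases eq_or_ne b ⊤ with htop | htop
  · rw [htop, ENNReal.mul_top (by norm_num)]
    exact le_top
  have hsum : b + b ≠ ⊤ := ENNReal.add_ne_top.2 ⟨htop, htop⟩
  have hu : eLpNormEssSup (w - ψ) (volume.restrict U₀) ≤ b + b := by
    rw [sub_eq_add_neg]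
    refine eLpNormEssSup_add_le.trans (add_le_add ?_ ?_)
    · rwa [← eLpNorm_exponent_top]
    · rwa [← eLpNorm_exponent_top, eLpNorm_neg]
  have hae : ∀ᵐ y ∂volume.restrict U₀, |(w - ψ) y| ≤ (b + b).toReal := by
    filter_upwards [ae_le_eLpNormEssSup (f := w - ψ) (μ := volume.restrict U₀)] with y hy
    have h1 := ENNReal.toReal_mono hsum (hy.trans hu)
    rwa [toReal_enorm, Real.norm_eq_abs] at h1
  have hηb : eLpNorm η ∞ (volume.restrict U) ≤ b + b := by
    rw [eLpNorm_exponent_top, ← ENNReal.ofReal_toReal hsum]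
    refine eLpNormEssSup_le_of_ae_bound ((ae_restrict_iff' hU).2 (ae_of_all _ fun x hx => ?_))
    rw [Real.norm_of_nonneg (hη0 x)]
    exact hη _ hae x hx
  have hψb : eLpNorm ψ ∞ (volume.restrict U) ≤ b :=
    (eLpNorm_mono_measure ψ (Measure.restrict_mono hUU₀ le_rfl)).trans hψ
  calc eLpNorm (ψ + η) ∞ (volume.restrict U)
      ≤ eLpNorm ψ ∞ (volume.restrict U) + eLpNorm η ∞ (volume.restrict U) := by
        simp only [eLpNorm_exponent_top]
        exact eLpNormEssSup_add_le
    _ ≤ b + (b + b) := add_le_add hψb hηb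
    _ = 3 * b := by ring
    _ ≤ 4 * b := by gcongr; norm_num

theorem tendsto_nhdsGT_zero_of_norm_le_mul {f : ℝ → ℝ} {C : ℝ}
    (h : ∀ ε, 0 < ε → |f ε| ≤ C * ε) : Tendsto f (𝓝[>] 0) (𝓝 0) := by
  have h1 : Tendsto (fun ε : ℝ => C * ε) (𝓝[>] 0) (𝓝 0) := by
    have hc : Continuous fun ε : ℝ => C * ε := by fun_prop
    simpa using (hc.tendsto 0).mono_left (nhdsWithin_le_nhds (s := Ioi 0))
  exact squeeze_zero_norm' (eventually_nhdsWithin_of_forall fun ε hε => h ε hε) h1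

/-- Approximation of a Sobolev function above an obstacle by functions as regular as the obstacle,
with a bound by the local suprema. -/
theorem exists_isRegularApprox {n : ℕ} (hn : 1 ≤ n)
    (Ω : Set (Euc n)) (hΩ : IsOpen Ω) (hΩb : Bornology.IsBounded Ω)
    {α q s : ℝ} (hα : 0 < α) (hq : 1 < q) (hqα : q ≤ 1 + α)
    {a : Euc n → ℝ} (ha : ∀ x ∈ Ω, 0 ≤ a x)
    (haα : ∃ C : ℝ, ∀ x ∈ Ω, ∀ y ∈ Ω, |a x - a y| ≤ C * ‖x - y‖ ^ α)
    {g : ℝ → ℝ} (hg : IsGrowthFunction g) {L : Euc n → ℝ} (hL : Continuous L)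
    (hLg : ∃ Λ : ℝ, 1 ≤ Λ ∧ ∀ z : Euc n, z ≠ 0 →
      1 / Λ * (‖z‖ * g ‖z‖) ≤ L z ∧ L z ≤ Λ * (‖z‖ * g ‖z‖) + Λ)
    {ψ : Euc n → ℝ} (hψ : MemW11Loc Ω ψ)
    (hψH : ∀ V, CompactlyIn V Ω → FiniteH L a s q ψ V)
    {w : Euc n → ℝ} (hw : MemKLoc ψ Ω w)
    (hwH : LocallyIntegrableOn (fun x => integrandH L a s q x (weakGrad Ω w x)) Ω)
    {Ω' : Set (Euc n)} (hΩ' : CompactlyIn Ω' Ω) :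
    ∃ v : ℝ → Euc n → ℝ, IsRegularApprox L g a s q ψ w Ω Ω' v ∧
      ∀ ε ∈ Ioo 0 (epsZero Ω' Ω),
        eLpNorm (v ε) ∞ (volume.restrict Ω') ≤
          4 * max (eLpNorm w ∞ (volume.restrict (Metric.thickening (epsZero Ω' Ω) Ω')))
            (eLpNorm ψ ∞ (volume.restrict (Metric.thickening (epsZero Ω' Ω) Ω'))) := by
  obtain ⟨Λ, hΛ, hLΛ⟩ := hLg
  obtain ⟨A₀, hA₀⟩ := haα
  obtain ⟨V, δ, hδ, hV, hΩ'V⟩ := hΩ'.exists_thickening hΩ hΩb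
  have hq0 : 0 < q := by linarith
  have hVΩ : V ⊆ Ω := subset_closure.trans hV.2.2
  have hsub : Ω' ⊆ V := (Metric.self_subset_cthickening Ω').trans hΩ'V
  have hVm : MeasurableSet V := hV.1.measurableSet
  have hUm : MeasurableSet Ω' := hΩ'.1.measurableSet
  have hVb : Bornology.IsBounded V := hΩb.subset hVΩ
  have hUb : Bornology.IsBounded Ω' := hVb.subset hsub
  have : IsFiniteMeasure (volume.restrict V) := ⟨by simpa using hVb.measure_lt_top⟩
  have : IsFiniteMeasure (volume.restrict Ω') := ⟨by simpa using hUb.measure_lt_top⟩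
  -- the coefficient
  set A : ℝ := max A₀ 0
  have haA : ∀ x ∈ Ω, ∀ y ∈ Ω, |a x - a y| ≤ A * ‖x - y‖ ^ α := fun x hx y hy =>
    (hA₀ x hx y hy).trans (by gcongr; exact le_max_left _ _)
  have hac : ContinuousOn a Ω := continuousOn_of_abs_sub_le_rpow hα haA
  have haV : IntegrableOn a V :=
    ((hac.mono hV.2.2).integrableOn_compact hV.2.1).mono_set subset_closure
  have haU : IntegrableOn a Ω' := haV.mono_set hsub
  have haV0 : ∀ᵐ x ∂volume.restrict V, 0 ≤ a x :=
    (ae_restrict_iff' hVm).2 (ae_of_all _ fun x hx => ha x (hVΩ hx))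
  have haU0 : ∀ᵐ x ∂volume.restrict Ω', 0 ≤ a x := ae_restrict_of_ae_restrict_of_subset hsub haV0
  -- the weak gradients
  have locV : ∀ {E : Type} [NormedAddCommGroup E] {f : Euc n → E}, LocallyIntegrableOn f Ω →
      IntegrableOn f V := fun hf =>
    (hf.integrableOn_compact_subset hV.2.2 hV.2.1).mono_set subset_closure
  have hwG := hw.1.isWeakGrad_weakGrad
  have hψG := hψ.isWeakGrad_weakGrad
  set Dw := weakGrad Ω w
  set Dψ := weakGrad Ω ψ
  have hwV : IntegrableOn w V := locV hwG.locInt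
  have hψV : IntegrableOn ψ V := locV hψG.locInt
  have hDwV : IntegrableOn Dw V := locV hwG.locInt_grad
  have hDψV : IntegrableOn Dψ V := locV hψG.locInt_grad
  have hNw : IntegrableOn (fun x => modDensity g q (a x) ‖Dw x‖) V :=
    hg.integrable_modDensity_of_integrandH hΛ hLΛ hq0 haV.aestronglyMeasurable haV0 hDwV
      (locV hwH)
  -- The hypothesis on `ψ` is stated with the weak gradient chosen on `V`; uniqueness allows passing
  -- to the one chosen on `Ω`.
  have hNψ : IntegrableOn (fun x => modDensity g q (a x) ‖Dψ x‖) V := by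
    refine hg.integrable_modDensity_of_integrandH (s := s) hΛ hLΛ hq0 haV.aestronglyMeasurable
      haV0 hDψV (Integrable.congr (hψH V hV) ?_)
    filter_upwards [(hψG.mono hVΩ).weakGrad_ae_eq hV.1] with x hx
    rw [hx]
  set u : Euc n → ℝ := w - ψ with hu_def
  set D : Euc n → Euc n := Dw - Dψ with hD_def
  have huD : IsWeakGrad Ω u D := hwG.sub hψG
  have hND : IntegrableOn (fun x => modDensity g q (a x) ‖D x‖) V :=
    hg.integrable_modDensity_sub hq0.le haV.aestronglyMeasurable haV0 hDwV.aestronglyMeasurable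
      hDψV.aestronglyMeasurable hNw hNψ
  have hu0 : ∀ᵐ x ∂volume.restrict V, 0 ≤ u x := by
    filter_upwards [ae_restrict_of_ae_restrict_of_subset hVΩ hw.2] with x hx
    simpa [hu_def] using hx
  -- the approximating family
  set r : ℝ := if 0 < epsZero Ω' Ω then epsZero Ω' Ω else 1 with hr_def
  have hr : 0 < r := by
    rw [hr_def]; split_ifs with h
    · exact h
    · exact one_pos
  -- The family is indexed by all reals; for `ε ≤ 0` an approximant of tolerance one is taken, which
  -- does not affect the limits at `0⁺`.
  have key : ∀ ε : ℝ, ∃ η : Euc n → ℝ, ContDiff ℝ ∞ η ∧ HasCompactSupport η ∧ (∀ x, 0 ≤ η x) ∧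
      (∀ M : ℝ, (∀ᵐ y ∂volume.restrict (Metric.thickening r Ω'), |u y| ≤ M) →
        ∀ x ∈ Ω', η x ≤ M) ∧
      (0 < ε → ∫ x in Ω', |η x - u x| < ε) ∧
      IntegrableOn (fun x => modDensity g q (a x) ‖gradient η x - D x‖) Ω' ∧
      (0 < ε → ∫ x in Ω', modDensity g q (a x) ‖gradient η x - D x‖ < ε) := by
    intro ε
    obtain ⟨η, h1, h2, h3, h4, h5, h6, h7⟩ := hg.exists_smooth_approx hq hα hqα
      (le_max_right A₀ 0) hV.1 hVb hUm hδ hΩ'V (fun x hx => ha x (hVΩ hx))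
      (fun x hx y hy => haA x (hVΩ hx) y (hVΩ hy)) (huD.mono hVΩ) (hwV.sub hψV) (hDwV.sub hDψV)
      hND hu0 hr (ε := if 0 < ε then ε else 1) (by split_ifs with h; exacts [h, one_pos])
    refine ⟨η, h1, h2, h3, h4, fun h => ?_, h6, fun h => ?_⟩
    · rwa [if_pos h] at h5
    · rwa [if_pos h] at h7
  choose η hηs hηc hη0 hηM hη1 hηi hηN using key
  have hvG : ∀ ε, IsWeakGrad Ω' (ψ + η ε) (Dψ + gradient (η ε)) := fun ε =>
    (hψG.mono hΩ'.2.2 |>.mono subset_closure).add ((hηs ε).isWeakGrad Ω')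
  have hvw : ∀ ε, IsWeakGrad Ω' (ψ + η ε - w) (Dψ + gradient (η ε) - Dw) := fun ε =>
    (hvG ε).sub (hwG.mono (hsub.trans hVΩ))
  have hDeq : ∀ ε x, (Dψ + gradient (η ε) - Dw) x = gradient (η ε) x - D x := fun ε x => by
    simp only [hD_def, Pi.sub_apply, Pi.add_apply]; abel
  have hvae : ∀ ε, weakGrad Ω' (ψ + η ε) =ᵐ[volume.restrict Ω'] Dψ + gradient (η ε) := fun ε =>
    (hvG ε).weakGrad_ae_eq hΩ'.1
  have hvwae : ∀ ε, weakGrad Ω' (ψ + η ε - w) =ᵐ[volume.restrict Ω']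
      fun x => gradient (η ε) x - D x := fun ε =>
    ((hvw ε).weakGrad_ae_eq hΩ'.1).trans (ae_of_all _ (hDeq ε))
  have hηi' : ∀ ε, IntegrableOn (η ε) Ω' := fun ε =>
    ((hηs ε).continuous.integrable_of_hasCompactSupport (hηc ε)).integrableOn
  have hgradm : ∀ ε, AEStronglyMeasurable (gradient (η ε)) (volume.restrict Ω') := fun ε =>
    (hηs ε).continuous_gradient.aestronglyMeasurable
  have hDm : AEStronglyMeasurable D (volume.restrict Ω') :=
    ((hDwV.sub hDψV).mono_set hsub).aestronglyMeasurable
  have hgD : ∀ ε, IntegrableOn (fun x => gradient (η ε) x - D x) Ω' := fun ε => by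
    refine (hηi ε).mono' ((hgradm ε).sub hDm) ?_
    filter_upwards [haU0] with x hx
    exact le_modDensity hx (norm_nonneg _)
  have hgD_le : ∀ ε, ∫ x in Ω', ‖gradient (η ε) x - D x‖ ≤
      ∫ x in Ω', modDensity g q (a x) ‖gradient (η ε) x - D x‖ := fun ε => by
    refine integral_mono_ae (hgD ε).norm (hηi ε) ?_
    filter_upwards [haU0] with x hx
    exact le_modDensity hx (norm_nonneg _)
  have hDwm : AEStronglyMeasurable Dw (volume.restrict Ω') :=
    (hDwV.mono_set hsub).aestronglyMeasurable
  have hvm : ∀ ε, AEStronglyMeasurable (Dψ + gradient (η ε)) (volume.restrict Ω') := fun ε =>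
    (hDψV.mono_set hsub).aestronglyMeasurable.add (hgradm ε)
  have hNsub : ∀ ε, IntegrableOn
      (fun x => modDensity g q (a x) ‖(Dψ + gradient (η ε)) x - Dw x‖) Ω' := fun ε =>
    (hηi ε).congr_fun (fun x _ => by simp only [← hDeq ε x, Pi.sub_apply]) hUm
  have hNlim : Tendsto (fun ε => ∫ x in Ω', modDensity g q (a x) ‖gradient (η ε) x - D x‖)
      (𝓝[>] 0) (𝓝 0) := by
    refine tendsto_nhdsGT_zero_of_norm_le_mul (C := 1) fun ε hε => ?_
    rw [one_mul, abs_of_nonneg]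
    · exact (hηN ε hε).le
    · refine integral_nonneg_of_ae ?_
      filter_upwards [haU0] with x hx
      exact modDensity_nonneg hx (norm_nonneg _)
  refine ⟨fun ε => ψ + η ε, ?_, ?_⟩
  swap
  · intro ε hε
    have hpos : 0 < epsZero Ω' Ω := hε.1.trans hε.2
    have hre : r = epsZero Ω' Ω := by rw [hr_def, if_pos hpos]
    rw [hre] at hηM
    exact eLpNorm_add_top_le_of_bound hUm (Metric.self_subset_thickening hpos Ω') (hη0 ε) (hηM ε)
  refine ⟨fun ε _ => ⟨⟨⟨_, hvG ε⟩, ?_, ?_⟩, ?_⟩, fun X hX ε _ => ?_, fun ε _ => ?_, fun ε _ => ?_,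
    fun ε _ => ?_, ?_, ?_, ?_⟩
  · exact (hψV.mono_set hsub).add (hηi' ε)
  · refine Integrable.congr ?_ (hvae ε).symm
    refine ((hDwV.mono_set hsub).add (hgD ε)).congr (ae_of_all _ fun x => ?_)
    simp only [hD_def, Pi.sub_apply, Pi.add_apply]; abel
  · exact ae_of_all _ fun x => by simpa using hη0 ε x
  · exact FunctionSpace.Mem.add_smooth hn hΩ'.1 hUb (hX Ω' hΩ') (hηs ε) (hηc ε)
  · exact ⟨η ε, hηs ε, hηc ε, ae_of_all _ fun x => rfl⟩
  -- The gradient of the approximant is that of `w` plus an error of finite modular, and finite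
  -- modular gives finite energy.
  · have h1 : IntegrableOn (fun x => modDensity g q (a x) ‖(Dψ + gradient (η ε)) x‖) Ω' := by
      have h2 := hg.integrable_modDensity_add hq0.le haU.aestronglyMeasurable haU0
        ((hvm ε).sub hDwm) hDwm (hNsub ε) (hNw.mono_set hsub)
      refine h2.congr (ae_of_all _ fun x => ?_)
      simp only [Pi.sub_apply, sub_add_cancel]
    refine Integrable.congr
      (hg.integrable_integrandH (s := s) hL hΛ hLΛ hq0 haU haU0 (hvm ε) h1) ?_
    filter_upwards [hvae ε] with x hx
    rw [hx]
  · refine Integrable.congr (hg.integrable_integrandG hq0.le haU.aestronglyMeasurable haU0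
      ((hgradm ε).sub hDm) (hηi ε)) ?_
    filter_upwards [hvwae ε] with x hx
    rw [hx]
    rfl
  · have h1 : ∀ ε, 0 < ε → normW11 Ω' (ψ + η ε - w) ≤ ENNReal.ofReal (2 * ε) := by
      intro ε hε
      have e1 : eLpNorm (ψ + η ε - w) 1 (volume.restrict Ω') =
          ENNReal.ofReal (∫ x in Ω', |η ε x - u x|) := by
        have hi : IntegrableOn (ψ + η ε - w) Ω' :=
          ((hψV.mono_set hsub).add (hηi' ε)).sub (hwV.mono_set hsub)
        rw [eLpNorm_one_eq_lintegral_enorm, ← ofReal_integral_norm_eq_lintegral_enorm hi]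
        congr 2; ext x
        simp only [hu_def, Pi.sub_apply, Pi.add_apply, Real.norm_eq_abs]
        congr 1; ring
      have e2 : eLpNorm (weakGrad Ω' (ψ + η ε - w)) 1 (volume.restrict Ω') =
          ENNReal.ofReal (∫ x in Ω', ‖gradient (η ε) x - D x‖) := by
        rw [eLpNorm_congr_ae (hvwae ε), eLpNorm_one_eq_lintegral_enorm,
          ← ofReal_integral_norm_eq_lintegral_enorm (hgD ε)]
      rw [normW11, e1, e2, ← ENNReal.ofReal_add (integral_nonneg fun x => abs_nonneg _)
        (integral_nonneg fun x => norm_nonneg _)]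
      refine ENNReal.ofReal_le_ofReal ?_
      linarith [hη1 ε hε, hηN ε hε, hgD_le ε]
    have h2 : Tendsto (fun ε : ℝ => ENNReal.ofReal (2 * ε)) (𝓝[>] 0) (𝓝 0) := by
      have hc : Continuous fun ε : ℝ => ENNReal.ofReal (2 * ε) :=
        ENNReal.continuous_ofReal.comp (continuous_const.mul continuous_id)
      have h3 := (hc.tendsto 0).mono_left (nhdsWithin_le_nhds (s := Ioi 0))
      rwa [mul_zero, ENNReal.ofReal_zero] at h3
    exact tendsto_of_tendsto_of_tendsto_of_le_of_le' tendsto_const_nhds h2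
      (Eventually.of_forall fun _ => zero_le) (eventually_nhdsWithin_of_forall fun ε hε => h1 ε hε)
  · have h1 := hg.tendsto_integral_integrandH (s := s) hL hΛ hLΛ hq0 haU haU0 (l := 𝓝[>] (0 : ℝ))
      (Z := fun ε => Dψ + gradient (η ε)) hvm hDwm (hNw.mono_set hsub) hNsub
      (hNlim.congr fun ε => by simp only [← hDeq ε, Pi.sub_apply])
    have e1 : energyH L a s q w Ω' = ∫ x in Ω', integrandH L a s q x (Dw x) := by
      refine integral_congr_ae ?_
      filter_upwards [(hwG.mono (hsub.trans hVΩ)).weakGrad_ae_eq hΩ'.1] with x hx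
      rw [hx]
    rw [e1]
    refine h1.congr fun ε => integral_congr_ae ?_
    filter_upwards [hvae ε] with x hx
    rw [hx]
  · refine tendsto_nhdsGT_zero_of_norm_le_mul (C := 1 + |g 0|) fun ε hε => ?_
    have e1 : modularG g a q (ψ + η ε - w) Ω' =
        ∫ x in Ω', integrandG g a q x ‖gradient (η ε) x - D x‖ := by
      refine integral_congr_ae ?_
      filter_upwards [hvwae ε] with x hx
      rw [hx]
    rw [e1, ← Real.norm_eq_abs]
    refine (norm_integral_le_of_norm_le ((hηi ε).const_mul (1 + |g 0|)) ?_).trans ?_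
    · filter_upwards [haU0] with x hx
      exact hg.abs_integrandG_le hx (norm_nonneg _)
    · rw [integral_const_mul]
      exact mul_le_mul_of_nonneg_left (hηN ε hε).le (by positivity)

theorem lemma3p2 {n : ℕ} (hn : 2 ≤ n)
    (Ω : Set (Euc n)) (hΩ : IsOpen Ω) (hΩb : Bornology.IsBounded Ω)
    -- the exponents and the modulating coefficient
    (α q s : ℝ) (hα : α ∈ Ioc (0 : ℝ) 1) (hq : 1 < q) (hs : s ∈ Icc (0 : ℝ) 1)
    (a : Euc n → ℝ) (ha : ∀ x ∈ Ω, 0 ≤ a x)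
    (haα : ∃ C : ℝ, ∀ x ∈ Ω, ∀ y ∈ Ω, |a x - a y| ≤ C * ‖x - y‖ ^ α)
    -- the nearly linear integrand
    (g : ℝ → ℝ) (hg : IsGrowthFunction g)
    (L : Euc n → ℝ) (hL : Continuous L)
    (hLg : ∃ Λ : ℝ, 1 ≤ Λ ∧ ∀ z : Euc n, z ≠ 0 →
      1 / Λ * (‖z‖ * g ‖z‖) ≤ L z ∧ L z ≤ Λ * (‖z‖ * g ‖z‖) + Λ)
    -- the obstacle
    (ψ : Euc n → ℝ) (hψ : MemW11Loc Ω ψ)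
    (hψH : ∀ V, CompactlyIn V Ω → FiniteH L a s q ψ V)
    -- the function to be approximated
    (w : Euc n → ℝ) (hw : MemKLoc ψ Ω w)
    (hwH : LocallyIntegrableOn (fun x => integrandH L a s q x (weakGrad Ω w x)) Ω)
    (Ω' : Set (Euc n)) (hΩ' : CompactlyIn Ω' Ω) :
    (q < 1 + α → ∃ v : ℝ → Euc n → ℝ, IsRegularApprox L g a s q ψ w Ω Ω' v) ∧
    (q ≤ 1 + α → MemLinftyLoc Ω w → MemLinftyLoc Ω ψ →
      ∃ v : ℝ → Euc n → ℝ, IsRegularApprox L g a s q ψ w Ω Ω' v ∧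
        ∀ ε ∈ Ioo 0 (epsZero Ω' Ω),
          eLpNorm (v ε) ∞ (volume.restrict Ω') ≤
            4 * max (eLpNorm w ∞ (volume.restrict (Metric.thickening (epsZero Ω' Ω) Ω')))
              (eLpNorm ψ ∞ (volume.restrict (Metric.thickening (epsZero Ω' Ω) Ω')))) := by

  refine ⟨fun hqα => ?_, fun hqα _ _ => ?_⟩
  · obtain ⟨v, hv, -⟩ := exists_isRegularApprox (by omega) Ω hΩ hΩb hα.1 hq hqα.le ha haα hg hL hLg
      hψ hψH hw hwH hΩ'
    exact ⟨v, hv⟩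
  · exact exists_isRegularApprox (by omega) Ω hΩ hΩb hα.1 hq hqα ha haα hg hL hLg hψ hψH hw hwH hΩ'
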